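/- **Setting.** A memoryless binary-input output-symmetric (MBIOS) channel has conditional output laws $P_0,P_1$ on a measurable space, exchanged by a measurable involution of the output alphabet, and is used independently for each transmitted bit. Let $C$ be its capacity in bits per channel use, let $L=\ln\frac{p(Y|0)}{p(Y|1)}\in[-\infty,\infty]$ be the log-likelihood ratio (LLR) of the output $Y$ when the input is $0$, let $a$ be the law of $L$ (possibly with atoms, also at $\infty$), and let $g_1=\mathbb{E}[\tanh^2(L/2)]$. Let $h_2(x)=-x\log_2x-(1-x)\log_2(1-x)$ and let $h_2^{-1}:[0,1]\to[0,\frac12]$ be its inverse, with $h_2^{-1}(y)=0$ for $y<0$. Let $\mathcal{C}$ be a binary linear block code of length $n$, with uniformly distributed transmitted codeword, represented by the Tanner graph of a full-rank parity-check matrix, and let $a_{\mathrm R}$ be the average degree of the parity-check nodes of this graph. Error and erasure probabilities $P_{\mathrm b}$ are averages over a fixed set of positions whose bits determine the codeword (e.g. all $n$ positions, or an information set). Let $\varepsilon\in(0,1)$. For $C,\varepsilon,P_{\mathrm b},g$ put $$B(C,\varepsilon,P_{\mathrm b},g)=\frac{2\ln\left(\frac{1}{1-2h_2^{-1}\left(\frac{1-C-h_2(P_{\mathrm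 b})}{1-(1-\varepsilon)C}\right)}\right)}{\ln\frac1g},$$ the bounds below being read as $0$ in the degenerate cases $C\in\{0,1\}$. **Theorem 1 (On the average degree of the parity-check nodes).** 1. $g_1=\int_{(0,\infty]}(1+e^{-l})\tanh^2\left(\frac l2\right)\,a(\mathrm{d}l)$. If the code has rate at least $(1-\varepsilon)C$ and achieves bit error probability $P_{\mathrm b}$ over the channel under some (possibly randomized) decoding algorithm, then $a_{\mathrm R}\ge B(C,\varepsilon,P_{\mathrm b},g_1)$. 2. The binary erasure channel (BEC) with erasure probability $p$ has capacity $1-p$. If the code has rate at least $(1-\varepsilon)(1-p)$ and achieves bit erasure probability $P_{\mathrm b}$ over this channel under some decoding algorithm that decodes every non-erased bit correctly (almost surely), then $$a_{\mathrm R}\ge\frac{\ln\left(1+\frac{p-P_{\mathrm b}}{(1-p)\varepsilon+P_{\mathrm b}}\right)}{\ln\frac{1}{1-p}}.$$ For $0\le P_{\mathrm b}\le\min(p,\frac12)$ the right side is at least $B(1-p,\varepsilon,P_{\mathrm b},g_1)$, with $g_1$ that of the BEC; that is, this bound is tighter than the general one. 3. Every MBIOS channel satisfies $C\le g_1\le\left(1-2h_2^{-1}(1-C)\right)^2$.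 The BEC with erasure probability $1-C$ and the binary symmetric channel (BSC) with crossover probability $h_2^{-1}(1-C)$ have capacity $C$ and attain the lower and the upper bound on $g_1$, respectively. Hence, among all MBIOS channels of fixed capacity $C$, for fixed $\varepsilon$ and every $P_{\mathrm b}\in[0,1]$, the bound $B(C,\varepsilon,P_{\mathrm b},g_1)$ attains its maximum for the BSC and its minimum for the BEC. -/

import Mathlib

open MeasureTheory ProbabilityTheory
open scoped ENNReal

namespace TannerBound

noncomputable section

/-! ### The binary entropy function to the base 2 and its inverse -/

/-- The binary entropy function `h₂(x) = -x log₂ x - (1-x) log₂ (1-x)`, in bits. -/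
def h2 (x : ℝ) : ℝ := Real.binEntropy x / Real.log 2

/-- The inverse `h₂⁻¹ : [0,1] → [0,1/2]` of the strictly increasing function `h₂ : [0,1/2] → [0,1]`.
Outside `[0,1]` it is extended monotonically, by `0` on the left and by `1/2` on the right. -/
def h2Inv (y : ℝ) : ℝ := sSup {x : ℝ | x ∈ Set.Icc 0 (1 / 2) ∧ h2 x ≤ y}

/-! ### Channels -/

/-- A (single use of a) memoryless binary-input output-symmetric channel: the conditional laws of
the output given the two inputs, exchanged by a measurable involution of the output alphabet. -/
structure MBIOSChannel (𝒴 : Type*) [MeasurableSpace 𝒴] where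
  /-- the law of the output given the input -/
  law : ZMod 2 → Measure 𝒴
  isProbabilityMeasure_law : ∀ x, IsProbabilityMeasure (law x)
  symmetric : ∃ T : 𝒴 → 𝒴, Measurable T ∧ Function.Involutive T ∧ law 1 = (law 0).map T

namespace MBIOSChannel

variable {𝒴 : Type*} [MeasurableSpace 𝒴]

instance (W : MBIOSChannel 𝒴) (x : ZMod 2) : IsProbabilityMeasure (W.law x) :=
  W.isProbabilityMeasure_law x

/-- The law of the output when the input is `1` with probability `q` and `0` otherwise. -/
def outputLaw (W : MBIOSChannel 𝒴) (q : unitInterval) : Measure 𝒴 :=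
  ENNReal.ofReal (1 - q) • W.law 0 + ENNReal.ofReal q • W.law 1

/-- The mutual information between input and output (in nats) when the input is `1` with
probability `q`: `I(X;Y) = ∑ₓ P(X = x) D(P_{Y|X=x} ‖ P_Y)`. -/
def mutualInfo (W : MBIOSChannel 𝒴) (q : unitInterval) : ℝ≥0∞ :=
  ENNReal.ofReal (1 - q) * InformationTheory.klDiv (W.law 0) (W.outputLaw q) +
    ENNReal.ofReal q * InformationTheory.klDiv (W.law 1) (W.outputLaw q)

/-- The channel capacity in bits per channel use: the largest mutual information over all input
distributions. -/
def capacity (W : MBIOSChannel 𝒴) : ℝ := (⨆ q : unitInterval, W.mutualInfo q).toReal / Real.log 2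

/-- The log-likelihood ratio `ln (p(y|0) / p(y|1))`, with values in `[-∞, ∞]`; the densities are
taken with respect to the sum of the two output laws. -/
def llr (W : MBIOSChannel 𝒴) (y : 𝒴) : EReal :=
  ENNReal.log ((W.law 0).rnDeriv (W.law 0 + W.law 1) y) -
    ENNReal.log ((W.law 1).rnDeriv (W.law 0 + W.law 1) y)

/-- The law `a` of the log-likelihood ratio at the channel output given that the input is `0`.
It may have atoms, also at `∞`. -/
def llrLaw (W : MBIOSChannel 𝒴) : Measure EReal := (W.law 0).map W.llr

end MBIOSChannel

/-- The function `l ↦ tanh (l / 2)` on `[-∞, ∞]`, with the values `±1` at `±∞`. -/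
def tanhHalf : EReal → ℝ
  | ⊥ => -1
  | ⊤ => 1
  | (l : ℝ) => Real.tanh (l / 2)

/-- `g₁ = E[tanh² (L / 2)]`, `L` being the log-likelihood ratio given that the input is `0`. -/
def MBIOSChannel.g1 {𝒴 : Type*} [MeasurableSpace 𝒴] (W : MBIOSChannel 𝒴) : ℝ :=
  ∫ l, tanhHalf l ^ 2 ∂W.llrLaw

/-- The binary symmetric channel with crossover probability `p`. -/
def bsc (p : unitInterval) : MBIOSChannel (ZMod 2) where
  law x := ENNReal.ofReal (1 - p) • Measure.dirac x + ENNReal.ofReal p • Measure.dirac (x + 1)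
  isProbabilityMeasure_law x := ⟨by
    simp only [Measure.coe_add, Measure.coe_smul, Pi.add_apply, Pi.smul_apply, measure_univ,
      smul_eq_mul, mul_one]
    rw [← ENNReal.ofReal_add (by linarith [p.2.2]) p.2.1]
    simp⟩
  symmetric := by
    refine ⟨fun y => y + 1, measurable_of_countable _, fun y => by revert y; decide, ?_⟩
    rw [Measure.map_add _ _ (measurable_of_countable _), Measure.map_smul, Measure.map_smul,
      Measure.map_dirac' (measurable_of_countable _), Measure.map_dirac' (measurable_of_countable _)]
    rfl

/-- Binary symbols with erasures (`none`) carry the discrete σ-algebra. -/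
instance : MeasurableSpace (Option (ZMod 2)) := ⊤

instance : DiscreteMeasurableSpace (Option (ZMod 2)) := ⟨fun _ => trivial⟩

/-- The binary erasure channel with erasure probability `p`; the output `none` is the erasure. -/
def bec (p : unitInterval) : MBIOSChannel (Option (ZMod 2)) where
  law x := ENNReal.ofReal (1 - p) • Measure.dirac (some x) + ENNReal.ofReal p • Measure.dirac none
  isProbabilityMeasure_law x := ⟨by
    simp only [Measure.coe_add, Measure.coe_smul, Pi.add_apply, Pi.smul_apply, measure_univ,
      smul_eq_mul, mul_one]
    rw [← ENNReal.ofReal_add (by linarith [p.2.2]) p.2.1]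
    simp⟩
  symmetric := by
    refine ⟨Option.map (fun x => x + 1), Measurable.of_discrete,
      fun y => by revert y; decide, ?_⟩
    rw [Measure.map_add _ _ Measurable.of_discrete, Measure.map_smul, Measure.map_smul,
      Measure.map_dirac' Measurable.of_discrete, Measure.map_dirac' Measurable.of_discrete]
    rfl

/-! ### Binary linear codes and their Tanner graphs -/

/-- The rate of a binary linear block code of length `n`. -/
def rate {n : ℕ} (𝒞 : Submodule (ZMod 2) (Fin n → ZMod 2)) : ℝ :=
  (Module.finrank (ZMod 2) 𝒞 : ℝ) / n

/-- `H` is a full-rank parity-check matrix of the code `𝒞`. -/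
def IsFullRankParityCheck {n m : ℕ} (H : Matrix (Fin m) (Fin n) (ZMod 2))
    (𝒞 : Submodule (ZMod 2) (Fin n → ZMod 2)) : Prop :=
  H.rank = m ∧ ∀ x, x ∈ 𝒞 ↔ H.mulVec x = 0

/-- The Tanner graph of a parity-check matrix: variable nodes on the left, parity-check nodes on the
right, and an edge for each nonzero entry. -/
def tannerGraph {n m : ℕ} (H : Matrix (Fin m) (Fin n) (ZMod 2)) : SimpleGraph (Fin n ⊕ Fin m) :=
  SimpleGraph.fromRel fun u v => ∃ i j, u = Sum.inl i ∧ v = Sum.inr j ∧ H j i ≠ 0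

/-- The average degree of the right (parity-check) nodes. -/
def avgRightDegree {n m : ℕ} (G : SimpleGraph (Fin n ⊕ Fin m)) : ℝ :=
  (∑ j : Fin m, ((G.neighborSet (Sum.inr j)).ncard : ℝ)) / m

/-- The codewords of `𝒞` are determined by their bits in the positions of `J`; for example, `J` is
the set of all positions, or an information set of `𝒞`. -/
def DeterminedBy {n : ℕ} (𝒞 : Submodule (ZMod 2) (Fin n → ZMod 2)) (J : Finset (Fin n)) : Prop :=
  ∀ x ∈ 𝒞, (∀ i ∈ J, x i = 0) → x = 0

/-! ### Transmission and decoding -/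

section Transmission

variable {𝒴 : Type*} [MeasurableSpace 𝒴] {n : ℕ} {𝒵 : Type*} [MeasurableSpace 𝒵]

/-- The law of the decoder output when `x` is sent over `n` independent uses of the channel `W` and
the received word is processed by the (possibly randomized) decoding algorithm `D`. -/
def decodedLaw (W : MBIOSChannel 𝒴) (D : Kernel (Fin n → 𝒴) 𝒵) (x : Fin n → ZMod 2) : Measure 𝒵 :=
  (Measure.pi fun i => W.law (x i)).bind D

open Classical in
/-- The probability of the event `E x i`, averaged over the codewords `x` of `𝒞` (all being sent
with equal probability) and over the positions `i` in `J`. -/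
def avgProb (𝒞 : Submodule (ZMod 2) (Fin n → ZMod 2)) (J : Finset (Fin n))
    (W : MBIOSChannel 𝒴) (D : Kernel (Fin n → 𝒴) 𝒵)
    (E : (Fin n → ZMod 2) → Fin n → Set 𝒵) : ℝ :=
  (∑ x with x ∈ 𝒞, (∑ i ∈ J, (decodedLaw W D x).real (E x i)) / J.card) / Nat.card 𝒞

/-- The bit error probability of the decoding algorithm `D` on the positions in `J`. -/
def bitErrorProb (𝒞 : Submodule (ZMod 2) (Fin n → ZMod 2)) (J : Finset (Fin n))
    (W : MBIOSChannel 𝒴) (D : Kernel (Fin n → 𝒴) (Fin n → ZMod 2)) : ℝ :=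
  avgProb 𝒞 J W D fun x i => {z | z i ≠ x i}

/-- The bit erasure probability, on the positions in `J`, of a decoding algorithm that may leave
bits erased. -/
def bitErasureProb (𝒞 : Submodule (ZMod 2) (Fin n → ZMod 2)) (J : Finset (Fin n))
    (W : MBIOSChannel 𝒴) (D : Kernel (Fin n → 𝒴) (Fin n → Option (ZMod 2))) : ℝ :=
  avgProb 𝒞 J W D fun _ i => {z | z i = none}

/-- The decoding algorithm `D` almost surely makes no undetected errors in the positions of `J`:
a bit that is not erased is decoded correctly, whichever codeword is sent. -/
def IsErasureDecoder (𝒞 : Submodule (ZMod 2) (Fin n → ZMod 2)) (J : Finset (Fin n))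
    (W : MBIOSChannel 𝒴) (D : Kernel (Fin n → 𝒴) (Fin n → Option (ZMod 2))) : Prop :=
  ∀ x ∈ 𝒞, ∀ i ∈ J, ∀ᵐ z ∂decodedLaw W D x, z i = none ∨ z i = some (x i)

end Transmission

/-! ### The two lower bounds -/

/-- The lower bound on the average right degree for a channel with capacity `C` and parameter
`g = g₁`, gap (in rate) to capacity `ε` and bit error probability `Pb`. -/
def rightDegreeBound (C ε Pb g : ℝ) : ℝ :=
  2 * Real.log (1 / (1 - 2 * h2Inv ((1 - C - h2 Pb) / (1 - (1 - ε) * C)))) / Real.log (1 / g)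

/-- The lower bound on the average right degree for the binary erasure channel with erasure
probability `p`, gap (in rate) to capacity `ε` and bit erasure probability `Pb`. -/
def becRightDegreeBound (p ε Pb : ℝ) : ℝ :=
  Real.log (1 + (p - Pb) / ((1 - p) * ε + Pb)) / Real.log (1 / (1 - p))

end

end TannerBound

/-! The proof compares two bounds on the equivocation H(X|Y) of the transmitted codeword.

A symmetric channel is described by the bias `s y` = E[(-1)^X | Y = y] under uniform input. The bias
has a symmetric law and equals tanh(L/2), so 1 - C is the mean of h₂((1 - s)/2) and g₁ is the mean
of s² (`exists_hasBias`, `capacity_eq`, `g1_eq`).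

Lower bound (`le_sum_weightedEntropy`, `le_integral_weightedEntropy`): by symmetry one may average
over the signs of the received biases. The codeword given the output then turns into additive noise
given its syndrome, with entropy H(noise) - H(syndrome). The noise contributes n(1 - C), and each
syndrome bit at most the entropy of a bit whose bias is the product of the biases of its neighbours.
The decisive analytic fact is that u ↦ `biasEntropy (√u)` is concave and decreasing
(`concaveOn_biasEntropy_sqrt`): Jensen over the output replaces the product by g₁^(deg/2), and
Jensen over the check nodes replaces the degrees by their average.

Upper bound (`integral_weightedEntropy_le_error`): Fano's inequality gives at most n h₂(P_b). Since
the number m of checks is at most n(1 - (1 - ε)C), it follows that 1 - C - h₂(P_b) ≤ (1 - (1 - ε)C)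
h₂((1 - g₁^(a_R/2))/2), which is solved for a_R.

On the BEC the bias takes values in {0, ±1}, where the entropy in bits is exactly 1 - s², and the
erasure probability takes the place of h₂(P_b); this yields the sharper bound. The concavity also
governs the extreme channels: the chord gives C ≤ g₁, and Jensen gives the upper bound on g₁. -/

namespace TannerBound

/-! ### Analytic properties of the binary entropy and of its inverse. -/

section Entropy

/-! ### The entropy of a bit of given bias -/

/-- The entropy, in nats, of a random bit `X` with `E[(-1)^X] = t`. -/
noncomputable def biasEntropy (t : ℝ) : ℝ := Real.binEntropy ((1 - t) / 2)

lemma continuous_biasEntropy : Continuous biasEntropy := by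
  unfold biasEntropy; fun_prop

lemma biasEntropy_neg (t : ℝ) : biasEntropy (-t) = biasEntropy t := by
  unfold biasEntropy
  rw [← Real.binEntropy_one_sub]
  congr 1; ring

lemma biasEntropy_zero : biasEntropy 0 = Real.log 2 := by
  unfold biasEntropy; rw [← Real.binEntropy_two_inv]; norm_num

lemma biasEntropy_one : biasEntropy 1 = 0 := by simp [biasEntropy]

lemma biasEntropy_le_log_two (t : ℝ) : biasEntropy t ≤ Real.log 2 := Real.binEntropy_le_log_two

lemma biasEntropy_nonneg {t : ℝ} (h : |t| ≤ 1) : 0 ≤ biasEntropy t := by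
  rw [abs_le] at h
  exact Real.binEntropy_nonneg (by linarith) (by linarith)

lemma biasEntropy_sqrt_sq (t : ℝ) : biasEntropy (Real.sqrt (t ^ 2)) = biasEntropy t := by
  rw [Real.sqrt_sq_eq_abs]
  rcases abs_choice t with h | h <;> rw [h]
  exact biasEntropy_neg t

lemma antitoneOn_biasEntropy : AntitoneOn biasEntropy (Set.Icc 0 1) := by
  intro a ha b hb hab
  apply Real.binEntropy_strictMonoOn.monotoneOn <;> try constructor
  all_goals (try simp only [Set.mem_Icc] at ha hb); linarith [ha.1, ha.2, hb.1, hb.2]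

lemma two_mul_biasEntropy (t : ℝ) : 2 * biasEntropy t =
    2 * Real.log 2 + Real.negMulLog (1 + t) + Real.negMulLog (1 - t) := by
  unfold biasEntropy
  rw [Real.binEntropy_eq_negMulLog_add_negMulLog_one_sub,
    show (1 - t) / 2 = 2⁻¹ * (1 - t) by ring, show 1 - 2⁻¹ * (1 - t) = 2⁻¹ * (1 + t) by ring,
    Real.negMulLog_mul, Real.negMulLog_mul, Real.negMulLog, Real.log_inv]
  ring

/-- The quotient is the power series ∑ 2 t^(2k) / (2k + 1), whose coefficients are nonnegative. -/
lemma monotoneOn_log_ratio_div :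
    MonotoneOn (fun t : ℝ => (Real.log (1 + t) - Real.log (1 - t)) / t) (Set.Ioo 0 1) := by
  have key : ∀ t ∈ Set.Ioo (0 : ℝ) 1, HasSum (fun k : ℕ => 2 * (1 / (2 * (k : ℝ) + 1)) * t ^ (2 * k))
      ((Real.log (1 + t) - Real.log (1 - t)) / t) := by
    intro t ht
    have := (Real.hasSum_log_sub_log_of_abs_lt_one (x := t)
      (by rw [abs_of_pos ht.1]; exact ht.2)).div_const t
    convert! this using 2 with k
    have := ht.1.ne'
    field_simp
    ring
  intro a ha b hb hab
  refine hasSum_le (fun k => ?_) (key a ha) (key b hb)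
  have := ha.1.le
  gcongr

lemma hasDerivAt_biasEntropy {t : ℝ} (ht : |t| < 1) :
    HasDerivAt biasEntropy (-(Real.log (1 + t) - Real.log (1 - t)) / 2) t := by
  rw [abs_lt] at ht
  have h1 : HasDerivAt (fun t : ℝ => (1 - t) / 2) (-1 / 2) t :=
    ((hasDerivAt_id t).const_sub 1).div_const 2
  have h2 := Real.hasDerivAt_binEntropy (p := (1 - t) / 2) (by linarith) (by linarith)
  convert! h2.comp t h1 using 1
  rw [show 1 - (1 - t) / 2 = (1 + t) / 2 by ring, Real.log_div (by linarith) (by norm_num),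
    Real.log_div (by linarith) (by norm_num)]
  ring

/-- With t = √u, the derivative in u is -(log (1 + t) - log (1 - t)) / (4t), which decreases by
`monotoneOn_log_ratio_div`. -/
lemma concaveOn_biasEntropy_sqrt :
    ConcaveOn ℝ (Set.Icc 0 1) fun u => biasEntropy (Real.sqrt u) := by
  have hd : ∀ u ∈ Set.Ioo (0 : ℝ) 1, HasDerivAt (fun u => biasEntropy (Real.sqrt u))
      (-((Real.log (1 + Real.sqrt u) - Real.log (1 - Real.sqrt u)) / Real.sqrt u) / 4) u := by
    intro u hu
    have h0 : 0 < Real.sqrt u := Real.sqrt_pos.2 hu.1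
    have h1 : Real.sqrt u < 1 := by rw [Real.sqrt_lt' one_pos]; simpa using hu.2
    have := (hasDerivAt_biasEntropy (t := Real.sqrt u) (by rwa [abs_of_pos h0])).comp u
      (Real.hasDerivAt_sqrt hu.1.ne')
    convert! this using 1
    field_simp
    ring
  apply AntitoneOn.concaveOn_of_deriv (convex_Icc 0 1)
  · exact (continuous_biasEntropy.comp Real.continuous_sqrt).continuousOn
  · rw [interior_Icc]
    exact fun u hu => (hd u hu).differentiableAt.differentiableWithinAt
  · rw [interior_Icc]
    intro a ha b hb hab
    rw [(hd a ha).deriv, (hd b hb).deriv]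
    have hm : ∀ u ∈ Set.Ioo (0 : ℝ) 1, Real.sqrt u ∈ Set.Ioo (0 : ℝ) 1 := fun u hu =>
      ⟨Real.sqrt_pos.2 hu.1, by rw [Real.sqrt_lt' one_pos]; simpa using hu.2⟩
    have := monotoneOn_log_ratio_div (hm a ha) (hm b hb) (Real.sqrt_le_sqrt hab)
    simp only at this
    linarith

lemma antitoneOn_biasEntropy_sqrt :
    AntitoneOn (fun u => biasEntropy (Real.sqrt u)) (Set.Icc 0 1) := by
  intro a ha b hb hab
  refine antitoneOn_biasEntropy ⟨Real.sqrt_nonneg _, ?_⟩ ⟨Real.sqrt_nonneg _, ?_⟩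
    (Real.sqrt_le_sqrt hab)
  · exact Real.sqrt_le_one.2 ha.2
  · exact Real.sqrt_le_one.2 hb.2

/-- A concave function lies above its chord; the values at u = 0 and u = 1 are log 2 and 0. -/
lemma one_sub_mul_log_two_le {u : ℝ} (h0 : 0 ≤ u) (h1 : u ≤ 1) :
    (1 - u) * Real.log 2 ≤ biasEntropy (Real.sqrt u) := by
  have := concaveOn_biasEntropy_sqrt.2 (x := 0) (y := 1) (by simp) (by simp)
    (sub_nonneg.2 h1) h0 (by ring)
  simpa [biasEntropy_zero, biasEntropy_one] using this

/-! ### The binary entropy function in bits and its inverse -/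

lemma h2_eq_biasEntropy (x : ℝ) : h2 x = biasEntropy (1 - 2 * x) / Real.log 2 := by
  unfold h2 biasEntropy; congr 2; ring

lemma log_two_pos : 0 < Real.log 2 := Real.log_pos one_lt_two

lemma continuous_h2 : Continuous h2 := by unfold h2; fun_prop

lemma h2_zero : h2 0 = 0 := by simp [h2]

lemma h2_half : h2 (1 / 2) = 1 := by
  have := log_two_pos.ne'
  rw [h2, show (1 / 2 : ℝ) = 2⁻¹ by norm_num, Real.binEntropy_two_inv, div_self this]

lemma h2_strictMonoOn : StrictMonoOn h2 (Set.Icc 0 (1 / 2)) := by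
  intro a ha b hb hab
  rw [one_div] at ha hb
  exact div_lt_div_of_pos_right (Real.binEntropy_strictMonoOn ha hb hab) log_two_pos

lemma h2_nonneg {x : ℝ} (h0 : 0 ≤ x) (h1 : x ≤ 1) : 0 ≤ h2 x :=
  div_nonneg (Real.binEntropy_nonneg h0 h1) log_two_pos.le

lemma one_sub_sq_le_h2 {x : ℝ} (h0 : 0 ≤ x) (h1 : x ≤ 1) : 1 - (1 - 2 * x) ^ 2 ≤ h2 x := by
  rw [h2_eq_biasEntropy, le_div_iff₀ log_two_pos, ← biasEntropy_sqrt_sq]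
  exact one_sub_mul_log_two_le (sq_nonneg _) (by nlinarith)

lemma le_h2_self {x : ℝ} (h0 : 0 ≤ x) (h1 : x ≤ 1 / 2) : x ≤ h2 x := by
  nlinarith [one_sub_sq_le_h2 h0 (by linarith)]

lemma h2Inv_mem (y : ℝ) : h2Inv y ∈ Set.Icc 0 (1 / 2 : ℝ) := by
  refine ⟨Real.sSup_nonneg fun x hx => hx.1.1, Real.sSup_le (fun x hx => hx.1.2) (by norm_num)⟩

/-- The form in which the inverse enters the degree bound. No range condition on `y` is needed: for
negative `y` the supremum is over the empty set and equals 0. -/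
lemma h2Inv_le {x y : ℝ} (hx : x ∈ Set.Icc 0 (1 / 2 : ℝ)) (h : y ≤ h2 x) : h2Inv y ≤ x :=
  Real.sSup_le (fun _ hz => (h2_strictMonoOn.le_iff_le hz.1 hx).1 (hz.2.trans h)) hx.1

lemma h2Inv_h2 {x : ℝ} (hx : x ∈ Set.Icc 0 (1 / 2 : ℝ)) : h2Inv (h2 x) = x :=
  le_antisymm (h2Inv_le hx le_rfl) (le_csSup ⟨1 / 2, fun _ hz => hz.1.2⟩ ⟨hx, le_rfl⟩)

lemma h2_h2Inv {y : ℝ} (h0 : 0 ≤ y) (h1 : y ≤ 1) : h2 (h2Inv y) = y := by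
  obtain ⟨x, hx, rfl⟩ := intermediate_value_Icc (show (0 : ℝ) ≤ 1 / 2 by norm_num)
    continuous_h2.continuousOn (show y ∈ Set.Icc (h2 0) (h2 (1 / 2)) by
      rw [h2_zero, h2_half]; exact ⟨h0, h1⟩)
  rw [h2Inv_h2 hx]

lemma h2Inv_one : h2Inv 1 = 1 / 2 := by
  have := h2Inv_h2 (x := 1 / 2) (by norm_num)
  rwa [h2_half] at this

lemma h2Inv_zero : h2Inv 0 = 0 := by
  conv_lhs => rw [← h2_zero]
  exact h2Inv_h2 (by norm_num)

lemma h2Inv_of_nonpos {y : ℝ} (h : y ≤ 0) : h2Inv y = 0 :=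
  le_antisymm (h2Inv_le (by norm_num) (by rwa [h2_zero])) (h2Inv_mem y).1

lemma h2Inv_lt_half {y : ℝ} (h : y < 1) : h2Inv y < 1 / 2 := by
  rcases le_or_gt y 0 with h0 | h0
  · rw [h2Inv_of_nonpos h0]; norm_num
  · refine (h2_strictMonoOn.lt_iff_lt (h2Inv_mem y) (by norm_num)).1 ?_
    rwa [h2_h2Inv h0.le h.le, h2_half]

lemma h2Inv_pos {y : ℝ} (h0 : 0 < y) (h1 : y ≤ 1) : 0 < h2Inv y := by
  refine (h2_strictMonoOn.lt_iff_lt (by norm_num) (h2Inv_mem y)).1 ?_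
  rwa [h2_h2Inv h0.le h1, h2_zero]

end Entropy

/-! ### Finite entropies and the syndrome of additive noise. -/

section FiniteEntropy

/-! ### Entropy of finite distributions -/

-- Gibbs' inequality, from log x ≤ x - 1. The reference weights `r` may have total mass below 1, as
-- happens for the image of an injective but not surjective map.
open Finset in
lemma sum_negMulLog_le_cross {Ω : Type*} (S : Finset Ω) (p r : Ω → ℝ) (hp : ∀ ω ∈ S, 0 ≤ p ω)
    (hr : ∀ ω ∈ S, 0 ≤ r ω) (hp1 : ∑ ω ∈ S, p ω = 1) (hr1 : ∑ ω ∈ S, r ω ≤ 1)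
    (hpr : ∀ ω ∈ S, r ω = 0 → p ω = 0) :
    ∑ ω ∈ S, Real.negMulLog (p ω) ≤ ∑ ω ∈ S, -(p ω * Real.log (r ω)) := by
  have : ∀ ω ∈ S, Real.negMulLog (p ω) ≤ -(p ω * Real.log (r ω)) + (r ω - p ω) := by
    intro ω hω
    rcases (hp ω hω).eq_or_lt with h | h
    · simp [← h, hr ω hω]
    · have hr0 : 0 < r ω := lt_of_le_of_ne (hr ω hω) fun h' => h.ne' (hpr ω hω h'.symm)
      have := mul_le_mul_of_nonneg_left (Real.log_le_sub_one_of_pos (div_pos hr0 h)) h.le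
      rw [Real.log_div hr0.ne' h.ne', mul_sub, mul_sub, mul_div_cancel₀ _ h.ne'] at this
      rw [Real.negMulLog]
      linarith
  have := sum_le_sum this
  rw [sum_add_distrib, sum_sub_distrib] at this
  linarith

lemma sum_zmod_two {M : Type*} [AddCommMonoid M] (f : ZMod 2 → M) : ∑ b, f b = f 0 + f 1 :=
  Fin.sum_univ_two f

open Finset in
/-- The cross entropy of a joint law of bits relative to the product of its marginals. -/
lemma sum_cross_eq_sum_binEntropy {Ω ι : Type*} [Fintype ι] (S : Finset Ω) (p : Ω → ℝ)
    (g : ι → Ω → ZMod 2) (m : ι → ZMod 2 → ℝ) (hm : ∀ i b, ∑ ω ∈ S with g i ω = b, p ω = m i b)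
    (hm1 : ∀ i, m i 0 + m i 1 = 1) (h0 : ∀ ω ∈ S, p ω ≠ 0 → ∀ i, m i (g i ω) ≠ 0) :
    ∑ ω ∈ S, -(p ω * Real.log (∏ i, m i (g i ω))) = ∑ i, Real.binEntropy (m i 1) := by
  calc _ = ∑ ω ∈ S, ∑ i, -(p ω * Real.log (m i (g i ω))) := by
        refine sum_congr rfl fun ω hω => ?_
        by_cases h : p ω = 0
        · simp [h]
        · rw [Real.log_prod fun i _ => h0 ω hω h i, mul_sum, sum_neg_distrib]
    _ = ∑ i, ∑ ω ∈ S, -(p ω * Real.log (m i (g i ω))) := sum_comm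
    _ = _ := by
        refine sum_congr rfl fun i _ => ?_
        rw [← sum_fiberwise S (g i), sum_zmod_two]
        have : ∀ b, ∑ ω ∈ S with g i ω = b, -(p ω * Real.log (m i (g i ω))) =
            Real.negMulLog (m i b) := by
          intro b
          rw [Real.negMulLog, ← hm, neg_mul, sum_mul, ← sum_neg_distrib]
          refine sum_congr rfl fun ω hω => ?_
          rw [(mem_filter.1 hω).2, ← hm]
        rw [this, this, Real.binEntropy_eq_negMulLog_add_negMulLog_one_sub, add_comm]
        congr 2
        linarith [hm1 i]

open Finset in
/-- The entropy of a random element that is determined by a family of bits is at most the sum of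
the entropies of these bits. -/
lemma sum_negMulLog_le_sum_binEntropy {Ω ι : Type*} [Fintype ι] (S : Finset Ω) (p : Ω → ℝ)
    (hp : ∀ ω ∈ S, 0 ≤ p ω) (hp1 : ∑ ω ∈ S, p ω = 1) (g : ι → Ω → ZMod 2)
    (hg : Set.InjOn (fun ω i => g i ω) S) :
    ∑ ω ∈ S, Real.negMulLog (p ω) ≤
      ∑ i, Real.binEntropy (∑ ω ∈ S with g i ω = 1, p ω) := by
  classical
  set m : ι → ZMod 2 → ℝ := fun i b => ∑ ω ∈ S with g i ω = b, p ω with hm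
  have hm0 : ∀ i b, 0 ≤ m i b := fun i b => sum_nonneg fun ω hω => hp ω (mem_filter.1 hω).1
  have hm1 : ∀ i, m i 0 + m i 1 = 1 := fun i => by
    rw [← sum_zmod_two, hm, sum_fiberwise, hp1]
  have hle : ∀ ω ∈ S, ∀ i, p ω ≤ m i (g i ω) := fun ω hω i =>
    single_le_sum (f := p) (fun ω' hω' => hp ω' (mem_filter.1 hω').1) (by simp [hω])
  rw [← sum_cross_eq_sum_binEntropy S p g m (fun _ _ => rfl) hm1 fun ω hω h i h' =>
    h (le_antisymm (h' ▸ hle ω hω i) (hp ω hω))]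
  -- Gibbs' inequality against the product of the marginals. Injectivity of the bits on `S` keeps
  -- the total reference mass at most 1.
  refine sum_negMulLog_le_cross S p _ hp (fun ω _ => prod_nonneg fun i _ => hm0 _ _) hp1 ?_ ?_
  · calc ∑ ω ∈ S, ∏ i, m i (g i ω)
        = ∑ f ∈ S.image (fun ω i => g i ω), ∏ i, m i (f i) := by
          rw [sum_image hg]
      _ ≤ ∑ f : ι → ZMod 2, ∏ i, m i (f i) :=
          sum_le_univ_sum_of_nonneg fun f => prod_nonneg fun i _ => hm0 _ _
      _ = ∏ i, ∑ b, m i b := by rw [prod_univ_sum, Fintype.piFinset_univ]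
      _ ≤ 1 := by simp [sum_zmod_two, hm1]
  · intro ω hω h
    obtain ⟨i, -, hi⟩ := prod_eq_zero_iff.1 h
    exact le_antisymm (hi ▸ hle ω hω i) (hp ω hω)

-- For a product law of bits this supplies the total mass, the marginals and the characters,
-- according to the choice of `φ`.
open Finset in
lemma sum_prod_mul_prod {ι : Type*} [Fintype ι] [DecidableEq ι] (m φ : ι → ZMod 2 → ℝ) :
    ∑ x : ι → ZMod 2, (∏ i, m i (x i)) * ∏ i, φ i (x i) = ∏ i, ∑ b, m i b * φ i b := by
  rw [prod_univ_sum, Fintype.piFinset_univ]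
  simp_rw [prod_mul_distrib]

open Finset in
/-- The entropy of independent bits is the sum of their entropies. -/
lemma sum_negMulLog_prod {ι : Type*} [Fintype ι] [DecidableEq ι] (m : ι → ZMod 2 → ℝ)
    (hm1 : ∀ i, m i 0 + m i 1 = 1) :
    ∑ x : ι → ZMod 2, Real.negMulLog (∏ i, m i (x i)) = ∑ i, Real.binEntropy (m i 1) := by
  rw [← sum_cross_eq_sum_binEntropy univ (fun x : ι → ZMod 2 => ∏ i, m i (x i)) (fun i x => x i) m
    ?_ hm1 fun x _ h i => (prod_ne_zero_iff.1 h) i (mem_univ i)]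
  · exact sum_congr rfl fun x _ => by rw [Real.negMulLog, neg_mul]
  · intro i b
    -- The test function is the indicator that bit `i` equals `b`, so the product formula gives the
    -- marginal.
    have := sum_prod_mul_prod m fun j c => if j = i then (if c = b then 1 else 0) else 1
    simp only [prod_ite_eq', mem_univ, if_true, mul_ite, mul_one, mul_zero] at this
    rw [sum_filter, this, prod_eq_single i]
    · simp
    · intro j _ hj
      simp [hj, sum_zmod_two, hm1]
    · simp

/-! ### Codes and noise -/

/-- The sign `(-1)^b` of a bit `b`. -/
def sgn (b : ZMod 2) : ℝ := if b = 0 then 1 else -1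

@[simp] lemma sgn_zero : sgn 0 = 1 := rfl

@[simp] lemma sgn_one : sgn 1 = -1 := if_neg (by decide)

lemma zmod_two_cases (b : ZMod 2) : b = 0 ∨ b = 1 := by revert b; decide

lemma sgn_add (a b : ZMod 2) : sgn (a + b) = sgn a * sgn b := by
  rcases zmod_two_cases a with rfl | rfl <;> rcases zmod_two_cases b with rfl | rfl <;>
    simp [show (1 + 1 : ZMod 2) = 0 from rfl]

lemma abs_sgn (b : ZMod 2) : |sgn b| = 1 := by
  rcases zmod_two_cases b with rfl | rfl <;> simp

lemma sgn_sq (b : ZMod 2) : sgn b ^ 2 = 1 := by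
  rcases zmod_two_cases b with rfl | rfl <;> simp

lemma sgn_sum {ι : Type*} (s : Finset ι) (f : ι → ZMod 2) :
    sgn (∑ i ∈ s, f i) = ∏ i ∈ s, sgn (f i) := by
  classical
  induction s using Finset.induction_on with
  | empty => simp
  | insert a s ha ih => rw [Finset.sum_insert ha, Finset.prod_insert ha, sgn_add, ih]

lemma one_add_sgn_mul_nonneg {t : ℝ} (ht : |t| ≤ 1) (b : ZMod 2) : 0 ≤ 1 + sgn b * t := by
  have : |sgn b * t| ≤ 1 := by rwa [abs_mul, abs_sgn, one_mul]
  linarith [(abs_le.1 this).1]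

variable {n m : ℕ}

/-- The likelihood ratio of the word `x` when bit `i` is received with bias `t i`. -/
def likelihood (x : Fin n → ZMod 2) (t : Fin n → ℝ) : ℝ := ∏ i, (1 + sgn (x i) * t i)

lemma likelihood_nonneg {t : Fin n → ℝ} (ht : ∀ i, |t i| ≤ 1) (x : Fin n → ZMod 2) :
    0 ≤ likelihood x t :=
  Finset.prod_nonneg fun i _ => one_add_sgn_mul_nonneg (ht i) _

/-- This turns an average over the signs of the biases into an average over additive noise. -/
lemma likelihood_sgn_mul (x w : Fin n → ZMod 2) (t : Fin n → ℝ) :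
    likelihood x (fun i => sgn (w i) * t i) = likelihood (x + w) t := by
  simp only [likelihood, Pi.add_apply, sgn_add, mul_assoc]

/-- The entropy of the posterior law of a uniformly chosen word of `S`, given that bit `i` is
received with bias `t i`, weighted by the likelihood ratio of this event. -/
noncomputable def weightedEntropy (S : Finset (Fin n → ZMod 2)) (t : Fin n → ℝ) : ℝ :=
  (∑ x ∈ S, Real.negMulLog (likelihood x t) - Real.negMulLog (∑ x ∈ S, likelihood x t)) / S.card

-- A syndrome bit is a sum of independent noise bits, bit `i` having bias `t i`; signs turn sums
-- into products, so biases multiply.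
open Finset in
lemma sum_sgn_syndrome (H : Matrix (Fin m) (Fin n) (ZMod 2)) (t : Fin n → ℝ) (j : Fin m) :
    ∑ v : Fin n → ZMod 2, (∏ i, (1 + sgn (v i) * t i) / 2) * sgn (H.mulVec v j) =
      ∏ i with H j i ≠ 0, t i := by
  have := sum_prod_mul_prod (fun i b => (1 + sgn b * t i) / 2) fun i b => sgn (H j i * b)
  simp only [← sgn_sum] at this
  simp only [Matrix.mulVec, dotProduct]
  rw [this, prod_filter]
  refine prod_congr rfl fun i _ => ?_
  rcases zmod_two_cases (H j i) with h | h <;> simp [h, sum_zmod_two] <;> ring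

-- Subadditivity of entropy over the syndrome bits, whose biases are given by `sum_sgn_syndrome`.
open Finset in
lemma syndrome_entropy_le (H : Matrix (Fin m) (Fin n) (ZMod 2)) {t : Fin n → ℝ}
    (ht : ∀ i, |t i| ≤ 1) :
    ∑ σ : Fin m → ZMod 2,
      Real.negMulLog (∑ v with H.mulVec v = σ, ∏ i, (1 + sgn (v i) * t i) / 2) ≤
      ∑ j, biasEntropy (∏ i with H j i ≠ 0, t i) := by
  set P : (Fin n → ZMod 2) → ℝ := fun v => ∏ i, (1 + sgn (v i) * t i) / 2 with hP
  have hP0 : ∀ v, 0 ≤ P v := fun v =>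
    prod_nonneg fun i _ => div_nonneg (one_add_sgn_mul_nonneg (ht i) _) two_pos.le
  have hP1 : ∑ v, P v = 1 := by
    have := sum_prod_mul_prod (fun i b => (1 + sgn b * t i) / 2) fun _ _ => 1
    simp only [prod_const_one, mul_one] at this
    rw [hP, this]
    refine prod_eq_one fun i _ => ?_
    rw [sum_zmod_two]; simp; ring
  refine (sum_negMulLog_le_sum_binEntropy univ (fun σ => ∑ v with H.mulVec v = σ, P v)
    (fun _ _ => sum_nonneg fun v _ => hP0 v) (by rw [sum_fiberwise, hP1])
    (fun (j : Fin m) (σ : Fin m → ZMod 2) => σ j) (fun σ _ σ' _ h => h)).trans_eq ?_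
  refine sum_congr rfl fun j _ => ?_
  rw [biasEntropy]
  congr 1
  have h1 : ∑ σ with σ j = 1, ∑ v with H.mulVec v = σ, P v = ∑ v with H.mulVec v j = 1, P v := by
    rw [sum_filter, sum_filter, ← sum_fiberwise univ H.mulVec]
    refine sum_congr rfl fun σ _ => ?_
    by_cases h : σ j = 1
    · rw [if_pos h]
      exact sum_congr rfl fun v hv => by rw [(mem_filter.1 hv).2, if_pos h]
    · rw [if_neg h]
      exact (sum_eq_zero fun v hv => by rw [(mem_filter.1 hv).2, if_neg h]).symm
  -- Summing 2·1[b = 1] + (-1)^b = 1 against the noise law expresses the probability of a one as (1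
  -- - bias)/2.
  rw [h1, ← sum_sgn_syndrome, sum_filter, eq_div_iff two_ne_zero, sum_mul, eq_sub_iff_add_eq,
    ← sum_add_distrib]
  refine Eq.trans (sum_congr rfl fun v _ => ?_) hP1
  rcases zmod_two_cases (H.mulVec v j) with h | h <;> simp [h, hP]
  ring

-- Full rank makes the syndrome map surjective, so every fibre is a nonempty coset of the code.
open Finset in
lemma card_filter_mulVec {𝒞 : Submodule (ZMod 2) (Fin n → ZMod 2)} [DecidablePred (· ∈ 𝒞)]
    {H : Matrix (Fin m) (Fin n) (ZMod 2)} (hH : IsFullRankParityCheck H 𝒞) (σ : Fin m → ZMod 2) :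
    #{w | H.mulVec w = σ} = #{x | x ∈ 𝒞} := by
  have hsurj : Function.Surjective H.mulVecLin := by
    rw [← LinearMap.range_eq_top]
    apply Submodule.eq_top_of_finrank_eq
    rw [← Matrix.rank, hH.1]; simp
  obtain ⟨w₀, hw₀⟩ := hsurj σ
  rw [Matrix.mulVecLin_apply] at hw₀
  refine card_bij (fun w _ => w - w₀) ?_ ?_ ?_
  · intro w hw
    simp only [mem_filter, mem_univ, true_and] at hw ⊢
    rw [hH.2, Matrix.mulVec_sub, hw, hw₀, sub_self]
  · intro a _ b _ h
    exact sub_left_injective h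
  · intro x hx
    simp only [mem_filter, mem_univ, true_and] at hx
    refine ⟨x + w₀, ?_, by simp⟩
    simp [Matrix.mulVec_add, (hH.2 x).1 hx, hw₀]

open Finset in
/-- The equivocation of a uniformly chosen codeword, averaged over all the sign patterns of the
received biases, is at least the entropy of the noise minus the entropies of the syndrome bits. -/
lemma le_sum_weightedEntropy {𝒞 : Submodule (ZMod 2) (Fin n → ZMod 2)} [DecidablePred (· ∈ 𝒞)]
    {H : Matrix (Fin m) (Fin n) (ZMod 2)} (hH : IsFullRankParityCheck H 𝒞) {t : Fin n → ℝ}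
    (ht : ∀ i, |t i| ≤ 1) :
    2 ^ n * (∑ i, biasEntropy (t i) - ∑ j, biasEntropy (∏ i with H j i ≠ 0, t i)) ≤
      ∑ w : Fin n → ZMod 2, weightedEntropy {x | x ∈ 𝒞} fun i => sgn (w i) * t i := by
  set P : (Fin n → ZMod 2) → ℝ := fun v => ∏ i, (1 + sgn (v i) * t i) / 2 with hP
  set S : Finset (Fin n → ZMod 2) := {x | x ∈ 𝒞} with hS
  set c : ℝ := 2 ^ n with hc
  have hc0 : 0 < c := by positivity
  have hK : (0 : ℝ) < #S := by
    exact_mod_cast card_pos.2 ⟨0, by simp [hS, 𝒞.zero_mem]⟩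
  -- `P` is the law of noise with independent bits of biases `t i`; the likelihood ratio is its
  -- density relative to the uniform law on words.
  have hlik : ∀ v, likelihood v t = c * P v := by
    intro v
    simp only [hP, prod_div_distrib, likelihood, hc]
    simp
    field_simp
  have hP1 : ∑ v, P v = 1 := by
    have := sum_prod_mul_prod (fun i b => (1 + sgn b * t i) / 2) fun _ _ => 1
    simp only [prod_const_one, mul_one] at this
    rw [hP, this]
    refine prod_eq_one fun i _ => ?_
    rw [sum_zmod_two]; simp; ring
  have hHP : ∑ v, Real.negMulLog (P v) = ∑ i, biasEntropy (t i) := by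
    rw [hP, sum_negMulLog_prod fun i b => (1 + sgn b * t i) / 2]
    · refine sum_congr rfl fun i _ => ?_
      simp [biasEntropy, sub_eq_add_neg]
    · intro i; simp; ring
  -- As `x` runs over the code, `x + w` runs over its coset, that is, over all words with the
  -- syndrome of `w`.
  have hfib : ∀ w, ∑ x ∈ S, P (x + w) = ∑ v with H.mulVec v = H.mulVec w, P v := by
    intro w
    refine sum_bij (fun x _ => x + w) ?_ ?_ ?_ fun _ _ => rfl
    · intro x hx
      simp only [hS, mem_filter, mem_univ, true_and] at hx ⊢
      rw [Matrix.mulVec_add, (hH.2 x).1 hx, zero_add]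
    · intro a _ b _ h
      exact add_left_injective w h
    · intro v hv
      simp only [hS, mem_filter, mem_univ, true_and] at hv ⊢
      exact ⟨v - w, by rw [hH.2, Matrix.mulVec_sub, hv, sub_self], by simp⟩
  have h1 : ∑ w : Fin n → ZMod 2, ∑ x ∈ S, Real.negMulLog (likelihood (x + w) t) =
      #S * (Real.negMulLog c + c * ∑ i, biasEntropy (t i)) := by
    rw [sum_comm]
    have : ∀ x ∈ S, ∑ w, Real.negMulLog (likelihood (x + w) t) =
        Real.negMulLog c + c * ∑ i, biasEntropy (t i) := by
      intro x _
      rw [Fintype.sum_equiv (Equiv.addLeft x) (fun w => Real.negMulLog (likelihood (x + w) t))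
        (fun v => Real.negMulLog (likelihood v t)) fun _ => rfl]
      simp only [hlik, Real.negMulLog_mul, sum_add_distrib]
      rw [← sum_mul, ← mul_sum, hP1, hHP, one_mul]
    rw [sum_congr rfl this, sum_const, nsmul_eq_mul]
  -- The total likelihood depends on `w` only through its syndrome, and each syndrome comes from
  -- `#S` words `w`.
  have h2 : ∑ w : Fin n → ZMod 2, Real.negMulLog (∑ x ∈ S, likelihood (x + w) t) =
      #S * (Real.negMulLog c +
        c * ∑ σ : Fin m → ZMod 2, Real.negMulLog (∑ v with H.mulVec v = σ, P v)) := by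
    rw [← sum_fiberwise univ H.mulVec]
    have : ∀ σ : Fin m → ZMod 2, ∑ w with H.mulVec w = σ,
        Real.negMulLog (∑ x ∈ S, likelihood (x + w) t) =
        #S * (c * Real.negMulLog (∑ v with H.mulVec v = σ, P v) +
          (∑ v with H.mulVec v = σ, P v) * Real.negMulLog c) := by
      intro σ
      rw [sum_congr rfl (g := fun _ => c * Real.negMulLog (∑ v with H.mulVec v = σ, P v) +
          (∑ v with H.mulVec v = σ, P v) * Real.negMulLog c), sum_const, nsmul_eq_mul,
          card_filter_mulVec hH]
      intro w hw
      simp only [hlik]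
      rw [← mul_sum, hfib, (mem_filter.1 hw).2, Real.negMulLog_mul]
      ring
    rw [sum_congr rfl fun σ _ => this σ, ← mul_sum, sum_add_distrib, ← mul_sum, ← sum_mul,
      sum_fiberwise, hP1]
    ring
  -- The normalization terms `negMulLog c` cancel; what remains is the entropy of the noise minus
  -- that of its syndrome.
  have h3 : ∑ w : Fin n → ZMod 2, weightedEntropy S (fun i => sgn (w i) * t i) =
      c * (∑ i, biasEntropy (t i) -
        ∑ σ : Fin m → ZMod 2, Real.negMulLog (∑ v with H.mulVec v = σ, P v)) := by
    simp only [weightedEntropy, likelihood_sgn_mul]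
    rw [← sum_div, sum_sub_distrib, h1, h2]
    field_simp
    ring
  rw [h3]
  exact mul_le_mul_of_nonneg_left (sub_le_sub_left (syndrome_entropy_le H ht) _) hc0.le

open Finset in
/-- The equivocation is at most the sum of the equivocations of bits that determine the word. -/
lemma weightedEntropy_le {S : Finset (Fin n → ZMod 2)} {J : Finset (Fin n)}
    (hJ : ∀ x ∈ S, ∀ y ∈ S, (∀ i ∈ J, x i = y i) → x = y) {t : Fin n → ℝ} (ht : ∀ i, |t i| ≤ 1) :
    weightedEntropy S t ≤ (∑ i ∈ J, (∑ x ∈ S, likelihood x t) *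
      Real.binEntropy ((∑ x ∈ S with x i = 1, likelihood x t) / ∑ x ∈ S, likelihood x t)) / #S := by
  have ha := fun x (_ : x ∈ S) => likelihood_nonneg ht x
  refine div_le_div_of_nonneg_right ?_ (Nat.cast_nonneg _)
  set A := ∑ x ∈ S, likelihood x t with hA
  rcases (sum_nonneg ha).eq_or_lt with h0 | h0
  · rw [← hA] at h0
    have : ∀ x ∈ S, likelihood x t = 0 := (sum_eq_zero_iff_of_nonneg ha).1 h0.symm
    rw [sum_congr rfl (g := fun _ => (0 : ℝ)) fun x hx => by rw [this x hx, Real.negMulLog_zero]]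
    simp [← h0]
  · rw [← hA] at h0
    have h1 : ∑ x ∈ S, likelihood x t / A = 1 := by rw [← sum_div, div_self h0.ne']
    have h2 := sum_negMulLog_le_sum_binEntropy S (fun x => likelihood x t / A)
      (fun x hx => div_nonneg (ha x hx) h0.le) h1 (fun (i : J) x => x i)
      fun x hx y hy h => hJ x hx y hy fun i hi => congr_fun h ⟨i, hi⟩
    simp only [← sum_div] at h2
    rw [sum_coe_sort J fun i => Real.binEntropy ((∑ x ∈ S with x i = 1, likelihood x t) / A)] at h2
    -- Normalizing by the total likelihood `A` shows that the numerator of `weightedEntropy` is `A`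
    -- times the posterior entropy.
    have h3 : ∑ x ∈ S, Real.negMulLog (likelihood x t) =
        Real.negMulLog A + A * ∑ x ∈ S, Real.negMulLog (likelihood x t / A) := by
      have : ∀ x ∈ S, Real.negMulLog (likelihood x t) =
          likelihood x t / A * Real.negMulLog A + A * Real.negMulLog (likelihood x t / A) := by
        intro x _
        rw [← Real.negMulLog_mul, mul_div_cancel₀ _ h0.ne']
      rw [sum_congr rfl this, sum_add_distrib, ← sum_mul, h1, one_mul, mul_sum]
    rw [h3, add_sub_cancel_left, ← mul_sum]
    exact mul_le_mul_of_nonneg_left h2 h0.le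

open Finset in
/-- The equivocation of a bit is at most the entropy of the error of any estimate of it, where
`δ b` is the probability that the estimate of the bit `b` is wrong. -/
lemma binEntropy_le_binEntropy_error {Ω : Type*} (S : Finset Ω) (a : Ω → ℝ) (ha : ∀ x ∈ S, 0 ≤ a x)
    (g : Ω → ZMod 2) (δ : ZMod 2 → ℝ) (hδ : ∀ b, 0 ≤ δ b) (hδ1 : δ 0 + δ 1 = 1) :
    (∑ x ∈ S, a x) * Real.binEntropy ((∑ x ∈ S with g x = 1, a x) / ∑ x ∈ S, a x) ≤
      (∑ x ∈ S, a x) * Real.binEntropy ((∑ x ∈ S, a x * δ (g x)) / ∑ x ∈ S, a x) := by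
  rcases (sum_nonneg ha).eq_or_lt with h0 | h0
  · simp [← h0]
  refine mul_le_mul_of_nonneg_left ?_ h0.le
  set A := ∑ x ∈ S, a x with hA
  set π := (∑ x ∈ S with g x = 1, a x) / A with hπ
  have hsplit : ∀ f : Ω → ℝ, ∑ x ∈ S, f x =
      ∑ x ∈ S with g x = 0, f x + ∑ x ∈ S with g x = 1, f x := fun f => by
    rw [← sum_fiberwise S g, sum_zmod_two]
  have hA0 : (∑ x ∈ S with g x = 0, a x) / A = 1 - π := by
    rw [hπ, eq_sub_iff_add_eq, ← add_div, ← hsplit, div_self h0.ne']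
  have hδA : ∀ b, ∑ x ∈ S with g x = b, a x * δ (g x) = (∑ x ∈ S with g x = b, a x) * δ b := by
    intro b
    rw [sum_mul]
    exact sum_congr rfl fun x hx => by rw [(mem_filter.1 hx).2]
  have he : (∑ x ∈ S, a x * δ (g x)) / A = δ 1 * π + δ 0 * (1 - π) := by
    rw [hsplit, hδA, hδA, ← hA0, hπ]; ring
  have hπ0 : 0 ≤ π := div_nonneg (sum_nonneg fun x hx => ha x (mem_filter.1 hx).1) h0.le
  have hπ1 : 0 ≤ 1 - π := hA0 ▸ div_nonneg (sum_nonneg fun x hx => ha x (mem_filter.1 hx).1) h0.le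
  -- The error probability is the mixture of `π` and `1 - π` with weights `δ 1` and `δ 0`. Both
  -- points have the same entropy, so concavity suffices.
  have := Real.strictConcave_binEntropy.concaveOn.2 (x := π) (y := 1 - π) ⟨hπ0, by linarith⟩
    ⟨hπ1, by linarith⟩ (hδ 1) (hδ 0) (by linarith)
  rw [Real.binEntropy_one_sub, ← add_smul, add_comm (δ 1), hδ1, one_smul] at this
  rwa [he]

end FiniteEntropy

/-! ### The bias representation of a symmetric channel and its capacity. -/

section Bias

/-! ### The bias of a channel output -/

/-- A symmetric channel described by the bias `s y` of the input bit given the output `y`: the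
output law under uniform input is `μ`, and `T` exchanges the two inputs. -/
structure MBIOSChannel.HasBias {𝒴 : Type*} [MeasurableSpace 𝒴] (W : MBIOSChannel 𝒴)
    (μ : Measure 𝒴) (s : 𝒴 → ℝ) (T : 𝒴 → 𝒴) : Prop where
  measurable : Measurable s
  abs_le : ∀ y, |s y| ≤ 1
  measurePreserving : MeasurePreserving T μ μ
  anti : ∀ y, s (T y) = -s y
  law_eq : ∀ x, W.law x = μ.withDensity fun y => ENNReal.ofReal (1 + sgn x * s y)

lemma withDensity_comp_of_involutive {𝒴 : Type*} [MeasurableSpace 𝒴] {μ : Measure 𝒴} {T : 𝒴 → 𝒴}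
    (hT : MeasurePreserving T μ μ) (hinv : Function.Involutive T) {f : 𝒴 → ℝ≥0∞}
    (hf : Measurable f) :
    (μ.withDensity f).map T = μ.withDensity fun y => f (T y) := by
  ext A hA
  rw [Measure.map_apply hT.measurable hA, withDensity_apply _ (hT.measurable hA),
    withDensity_apply _ hA]
  have := hT.setLIntegral_comp_preimage hA (hf.comp hT.measurable)
  simpa only [Function.comp_apply, hinv _] using this

variable {𝒴 : Type*} [MeasurableSpace 𝒴] {W : MBIOSChannel 𝒴} {μ : Measure 𝒴} {s : 𝒴 → ℝ}
  {T : 𝒴 → 𝒴}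

lemma MBIOSChannel.HasBias.of_law_zero (hs : Measurable s) (hs1 : ∀ y, |s y| ≤ 1)
    (hT : MeasurePreserving T μ μ) (hinv : Function.Involutive T) (ha : ∀ y, s (T y) = -s y)
    (h0 : W.law 0 = μ.withDensity fun y => ENNReal.ofReal (1 + s y))
    (h1 : W.law 1 = (W.law 0).map T) : W.HasBias μ s T := by
  refine ⟨hs, hs1, hT, ha, fun x => ?_⟩
  rcases zmod_two_cases x with rfl | rfl
  · simpa using h0
  · rw [h1, h0, withDensity_comp_of_involutive hT hinv (by fun_prop)]
    simp [ha]

-- Take for `μ` the output law under uniform input and let f = dP₀/dμ. Then f ∘ T = dP₁/dμ and f + f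
-- ∘ T = 2 almost everywhere, so s = (f - f ∘ T)/2 satisfies 1 + s = f.
open MBIOSChannel in
lemma exists_hasBias (W : MBIOSChannel 𝒴) : ∃ μ s T, IsProbabilityMeasure μ ∧ W.HasBias μ s T := by
  obtain ⟨T, hTm, hinv, h1⟩ := W.symmetric
  have h0 : W.law 0 = (W.law 1).map T := by
    rw [h1, Measure.map_map hTm hTm, hinv.comp_self, Measure.map_id]
  set μ : Measure 𝒴 := (2⁻¹ : ℝ≥0∞) • (W.law 0 + W.law 1) with hμ
  have hprob : IsProbabilityMeasure μ := ⟨by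
    simp only [hμ, Measure.coe_smul, Measure.coe_add, Pi.smul_apply, Pi.add_apply, measure_univ,
      smul_eq_mul, one_add_one_eq_two]
    exact ENNReal.inv_mul_cancel (by norm_num) (by norm_num)⟩
  have hmap : μ.map T = μ := by
    rw [hμ, Measure.map_smul, Measure.map_add _ _ hTm, ← h0, ← h1, add_comm]
  have hT : MeasurePreserving T μ μ := ⟨hTm, hmap⟩
  have hsum : W.law 0 + W.law 1 = (2 : ℝ≥0∞) • μ := by
    rw [hμ, smul_smul, ENNReal.mul_inv_cancel (by norm_num) (by norm_num), one_smul]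
  have hac : W.law 0 ≪ μ := by
    refine Measure.AbsolutelyContinuous.mk fun A _ hA => ?_
    have : (W.law 0 + W.law 1) A = 0 := by rw [hsum]; simp [hA]
    simp only [Measure.coe_add, Pi.add_apply, add_eq_zero] at this
    exact this.1
  set f := (W.law 0).rnDeriv μ with hf
  have hfm : Measurable f := Measure.measurable_rnDeriv _ _
  have hlaw0 : W.law 0 = μ.withDensity f := (Measure.withDensity_rnDeriv_eq _ _ hac).symm
  have hlaw1 : W.law 1 = μ.withDensity fun y => f (T y) := by
    rw [h1, hlaw0, withDensity_comp_of_involutive hT hinv hfm]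
  have hae : (fun y => f y + f (T y)) =ᵐ[μ] fun _ => 2 := by
    have : μ.withDensity (fun y => f y + f (T y)) = μ.withDensity fun _ => 2 := by
      rw [withDensity_const, ← hsum]
      exact (withDensity_add_left hfm _).trans (congr_arg₂ _ hlaw0.symm hlaw1.symm)
    refine (withDensity_eq_iff (by fun_prop) (by fun_prop) ?_).1 this
    rw [← setLIntegral_univ, ← withDensity_apply _ MeasurableSet.univ, this]
    simp
  -- Clamping makes |s| ≤ 1 hold everywhere. It preserves oddness under `T` and changes nothing
  -- almost everywhere, because f and f ∘ T are nonnegative with sum 2.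
  refine ⟨μ, fun y => max (-1) (min 1 (((f y).toReal - (f (T y)).toReal) / 2)), T, hprob,
    MBIOSChannel.HasBias.of_law_zero (by fun_prop) (fun y => ?_) hT hinv (fun y => ?_) ?_ h1⟩
  · rw [_root_.abs_le]
    exact ⟨le_max_left _ _, max_le (by norm_num) (min_le_left _ _)⟩
  · rw [hinv y]
    grind
  · rw [hlaw0]
    refine withDensity_congr_ae ?_
    filter_upwards [hae] with y hy
    have hf1 : f y ≠ ∞ := fun h => by rw [h] at hy; simp at hy
    have hf2 : f (T y) ≠ ∞ := fun h => by rw [h] at hy; simp at hy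
    have h2 : (f y).toReal + (f (T y)).toReal = 2 := by
      rw [← ENNReal.toReal_add hf1 hf2, hy]; rfl
    have e1 := ENNReal.toReal_nonneg (a := f y)
    have e2 := ENNReal.toReal_nonneg (a := f (T y))
    refine (ENNReal.ofReal_toReal hf1).symm.trans (congr_arg _ ?_)
    generalize (f y).toReal = a at *
    generalize (f (T y)).toReal = b at *
    rw [min_eq_right (by linarith), max_eq_right (by linarith)]
    linarith

namespace MBIOSChannel.HasBias

lemma one_add_nonneg (h : W.HasBias μ s T) (x : ZMod 2) (y : 𝒴) : 0 ≤ 1 + sgn x * s y :=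
  one_add_sgn_mul_nonneg (h.abs_le y) x

lemma integral_law (h : W.HasBias μ s T) (x : ZMod 2) (f : 𝒴 → ℝ) :
    ∫ y, f y ∂W.law x = ∫ y, (1 + sgn x * s y) * f y ∂μ := by
  have := h.measurable
  rw [h.law_eq, integral_withDensity_eq_integral_toReal_smul (by fun_prop) (by simp)]
  simp only [ENNReal.toReal_ofReal (h.one_add_nonneg x _), smul_eq_mul]

/-- The law of the bias under `μ` is symmetric, since `T` preserves `μ` and negates `s`. -/
lemma integral_comp_neg (h : W.HasBias μ s T) {φ : ℝ → ℝ} (hφ : Measurable φ) :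
    ∫ y, φ (-s y) ∂μ = ∫ y, φ (s y) ∂μ := by
  have := integral_map (μ := μ) h.measurePreserving.aemeasurable
    (hφ.comp h.measurable).aestronglyMeasurable
  rw [h.measurePreserving.map_eq] at this
  simpa only [Function.comp_apply, h.anti] using this.symm

lemma integrable_comp [IsFiniteMeasure μ] (h : W.HasBias μ s T) {φ : ℝ → ℝ}
    (hφ : Continuous φ) : Integrable (fun y => φ (s y)) μ := by
  obtain ⟨C, hC⟩ := (isCompact_Icc (a := (-1 : ℝ)) (b := 1)).exists_bound_of_continuousOn
    hφ.continuousOn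
  exact Integrable.of_bound (hφ.measurable.comp h.measurable).aestronglyMeasurable C
    (ae_of_all _ fun y => hC _ (_root_.abs_le.1 (h.abs_le y)))

lemma integral_eq_zero (h : W.HasBias μ s T) : ∫ y, s y ∂μ = 0 := by
  have := h.integral_comp_neg measurable_id
  simp only [id, integral_neg] at this
  linarith

/-! ### Capacity -/

lemma outputLaw_eq (h : W.HasBias μ s T) (q : unitInterval) :
    W.outputLaw q = μ.withDensity fun y => ENNReal.ofReal (1 + (1 - 2 * q) * s y) := by
  have := h.measurable
  rw [outputLaw, h.law_eq, h.law_eq, ← withDensity_smul _ (by fun_prop),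
    ← withDensity_smul _ (by fun_prop), ← withDensity_add_left (by fun_prop)]
  congr 1
  ext y
  have h0 := h.one_add_nonneg 0 y
  have h1 := h.one_add_nonneg 1 y
  have hq0 := q.2.1
  have hq1 : 0 ≤ 1 - (q : ℝ) := sub_nonneg.2 q.2.2
  simp only [Pi.add_apply, Pi.smul_apply, smul_eq_mul]
  rw [← ENNReal.ofReal_mul hq1, ← ENNReal.ofReal_mul hq0,
    ← ENNReal.ofReal_add (by positivity) (by positivity)]
  simp
  congr 1; ring

/-- Positivity of `g` gives absolute continuity with density f / g. The `klFun` integrand is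
nonnegative, so no integrability of the log-likelihood is required. -/
lemma _root_.TannerBound.klDiv_withDensity [IsFiniteMeasure μ] {f g : 𝒴 → ℝ} (hf : Measurable f) (hg : Measurable g)
    (hf0 : ∀ y, 0 ≤ f y) (hg0 : ∀ y, 0 < g y)
    [IsFiniteMeasure (μ.withDensity fun y => ENNReal.ofReal (f y))]
    [IsFiniteMeasure (μ.withDensity fun y => ENNReal.ofReal (g y))] :
    InformationTheory.klDiv (μ.withDensity fun y => ENNReal.ofReal (f y))
      (μ.withDensity fun y => ENNReal.ofReal (g y)) =
    ∫⁻ y, ENNReal.ofReal (g y * InformationTheory.klFun (f y / g y)) ∂μ := by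
  have heq : μ.withDensity (fun y => ENNReal.ofReal (f y)) =
      (μ.withDensity fun y => ENNReal.ofReal (g y)).withDensity
        fun y => ENNReal.ofReal (f y / g y) := by
    rw [← withDensity_mul _ (by fun_prop) (by fun_prop)]
    congr 1
    ext y
    rw [Pi.mul_apply, ← ENNReal.ofReal_mul (hg0 y).le, mul_div_cancel₀ _ (hg0 y).ne']
  have hac : μ.withDensity (fun y => ENNReal.ofReal (f y)) ≪
      μ.withDensity fun y => ENNReal.ofReal (g y) := by
    rw [heq]; exact withDensity_absolutelyContinuous _ _
  rw [InformationTheory.klDiv_eq_lintegral_klFun_of_ac hac]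
  have hrn : (μ.withDensity fun y => ENNReal.ofReal (f y)).rnDeriv
      (μ.withDensity fun y => ENNReal.ofReal (g y)) =ᵐ[μ.withDensity fun y => ENNReal.ofReal (g y)]
      fun y => ENNReal.ofReal (f y / g y) := by
    conv_lhs => rw [heq]
    exact Measure.rnDeriv_withDensity _ (by fun_prop)
  rw [lintegral_congr_ae (g := fun y =>
      ENNReal.ofReal (InformationTheory.klFun (f y / g y))) (by
    filter_upwards [hrn] with y hy
    rw [hy, ENNReal.toReal_ofReal (div_nonneg (hf0 y) (hg0 y).le)])]
  have := InformationTheory.measurable_klFun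
  rw [lintegral_withDensity_eq_lintegral_mul _ (by fun_prop) (by fun_prop)]
  refine lintegral_congr fun y => ?_
  rw [Pi.mul_apply, ← ENNReal.ofReal_mul (hg0 y).le]

lemma integral_negMulLog (h : W.HasBias μ s T) [IsProbabilityMeasure μ] :
    ∫ y, Real.negMulLog (1 + s y) ∂μ = - ∫ y, (Real.log 2 - biasEntropy (s y)) ∂μ := by
  have hn : ∫ y, Real.negMulLog (1 - s y) ∂μ = ∫ y, Real.negMulLog (1 + s y) ∂μ := by
    have := h.integral_comp_neg (φ := fun t => Real.negMulLog (1 + t)) (by fun_prop)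
    simpa only [sub_eq_add_neg] using this
  have e : ∀ y, Real.log 2 - biasEntropy (s y) =
      -2⁻¹ * (Real.negMulLog (1 + s y) + Real.negMulLog (1 - s y)) := fun y => by
    linarith [two_mul_biasEntropy (s y)]
  simp only [e]
  rw [integral_const_mul, integral_add (h.integrable_comp (φ := fun t => Real.negMulLog (1 + t))
    (by fun_prop)) (h.integrable_comp (φ := fun t => Real.negMulLog (1 - t)) (by fun_prop)), hn]
  ring

/-- The last integral is minus the divergence of the output law from `μ`, so this displays the loss
against uniform input. Excluding q = 0 and q = 1 keeps the output density positive. -/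
lemma mutualInfo_eq (h : W.HasBias μ s T) [IsProbabilityMeasure μ] {q : unitInterval}
    (hq0 : 0 < (q : ℝ)) (hq1 : (q : ℝ) < 1) :
    W.mutualInfo q = ENNReal.ofReal (∫ y, (Real.log 2 - biasEntropy (s y)) ∂μ +
      ∫ y, Real.negMulLog (1 + (1 - 2 * q) * s y) ∂μ) := by
  have hs := h.measurable
  have hg0 : ∀ y, 0 < 1 + (1 - 2 * (q : ℝ)) * s y := by
    intro y
    have h1 : |1 - 2 * (q : ℝ)| < 1 := abs_lt.2 ⟨by linarith, by linarith⟩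
    have h2 := mul_le_of_le_one_right (abs_nonneg (1 - 2 * (q : ℝ))) (h.abs_le y)
    rw [← abs_mul] at h2
    linarith [(abs_lt.1 (h2.trans_lt h1)).1]
  have hfin : ∀ x, IsFiniteMeasure (μ.withDensity fun y => ENNReal.ofReal (1 + sgn x * s y)) :=
    fun x => by rw [← h.law_eq]; infer_instance
  have hfing : IsFiniteMeasure
      (μ.withDensity fun y => ENNReal.ofReal (1 + (1 - 2 * (q : ℝ)) * s y)) :=
    isFiniteMeasure_withDensity_ofReal
      (h.integrable_comp (φ := fun t => 1 + (1 - 2 * (q : ℝ)) * t) (by fun_prop)).2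
  have key : ∀ x, InformationTheory.klDiv (W.law x) (W.outputLaw q) =
      ∫⁻ y, ENNReal.ofReal ((1 + (1 - 2 * (q : ℝ)) * s y) *
        InformationTheory.klFun ((1 + sgn x * s y) / (1 + (1 - 2 * (q : ℝ)) * s y))) ∂μ := by
    intro x
    rw [h.law_eq, h.outputLaw_eq, klDiv_withDensity (by fun_prop) (by fun_prop)
      (h.one_add_nonneg x) hg0]
  have hk := InformationTheory.measurable_klFun
  have hnn : ∀ x y, 0 ≤ (1 + (1 - 2 * (q : ℝ)) * s y) *
        InformationTheory.klFun ((1 + sgn x * s y) / (1 + (1 - 2 * (q : ℝ)) * s y)) := fun x y =>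
    mul_nonneg (hg0 y).le (InformationTheory.klFun_nonneg
      (div_nonneg (h.one_add_nonneg x y) (hg0 y).le))
  have hq1' : 0 ≤ 1 - (q : ℝ) := by linarith
  rw [mutualInfo, key, key, ← lintegral_const_mul _ (by fun_prop),
    ← lintegral_const_mul _ (by fun_prop), ← lintegral_add_left (by fun_prop)]
  have e : ∀ y, ENNReal.ofReal (1 - q) * ENNReal.ofReal ((1 + (1 - 2 * (q : ℝ)) * s y) *
        InformationTheory.klFun ((1 + sgn 0 * s y) / (1 + (1 - 2 * (q : ℝ)) * s y))) +
      ENNReal.ofReal q * ENNReal.ofReal ((1 + (1 - 2 * (q : ℝ)) * s y) *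
        InformationTheory.klFun ((1 + sgn 1 * s y) / (1 + (1 - 2 * (q : ℝ)) * s y))) =
      ENNReal.ofReal (-((1 - q) * Real.negMulLog (1 + s y)) - q * Real.negMulLog (1 + -s y) +
        Real.negMulLog (1 + (1 - 2 * (q : ℝ)) * s y)) ∧
      0 ≤ (-((1 - q) * Real.negMulLog (1 + s y)) - q * Real.negMulLog (1 + -s y) +
        Real.negMulLog (1 + (1 - 2 * (q : ℝ)) * s y)) := by
    intro y
    have hg := (hg0 y).ne'
    have e1 : ∀ x, (1 + (1 - 2 * (q : ℝ)) * s y) *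
        InformationTheory.klFun ((1 + sgn x * s y) / (1 + (1 - 2 * (q : ℝ)) * s y)) =
        -Real.negMulLog (1 + sgn x * s y) - (1 + sgn x * s y) *
          Real.log (1 + (1 - 2 * (q : ℝ)) * s y) + (1 + (1 - 2 * (q : ℝ)) * s y) -
          (1 + sgn x * s y) := by
      intro x
      rw [InformationTheory.klFun_apply, Real.negMulLog]
      rcases (h.one_add_nonneg x y).eq_or_lt with h' | h'
      · simp [← h']
      · rw [Real.log_div h'.ne' hg]
        generalize Real.log (1 + sgn x * s y) = a
        generalize Real.log (1 + (1 - 2 * (q : ℝ)) * s y) = b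
        field_simp
    -- The affine terms of `klFun` cancel because the output density is the mixture of the two input
    -- densities.
    have e2 : (1 - q) * ((1 + (1 - 2 * (q : ℝ)) * s y) *
        InformationTheory.klFun ((1 + sgn 0 * s y) / (1 + (1 - 2 * (q : ℝ)) * s y))) +
        q * ((1 + (1 - 2 * (q : ℝ)) * s y) *
        InformationTheory.klFun ((1 + sgn 1 * s y) / (1 + (1 - 2 * (q : ℝ)) * s y))) =
      (-((1 - q) * Real.negMulLog (1 + s y)) - q * Real.negMulLog (1 + -s y) +
        Real.negMulLog (1 + (1 - 2 * (q : ℝ)) * s y)) := by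
      rw [e1, e1]
      simp only [sgn_zero, sgn_one, one_mul, neg_one_mul, Real.negMulLog]
      ring
    constructor
    · rw [← ENNReal.ofReal_mul hq1', ← ENNReal.ofReal_mul hq0.le, ← ENNReal.ofReal_add
        (mul_nonneg hq1' (hnn 0 y)) (mul_nonneg hq0.le (hnn 1 y)), e2]
    · rw [← e2]
      exact add_nonneg (mul_nonneg hq1' (hnn 0 y)) (mul_nonneg hq0.le (hnn 1 y))
  rw [lintegral_congr fun y => (e y).1, ← ofReal_integral_eq_lintegral_ofReal
    (h.integrable_comp (φ := fun t => -((1 - q) * Real.negMulLog (1 + t)) -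
      q * Real.negMulLog (1 + -t) + Real.negMulLog (1 + (1 - 2 * (q : ℝ)) * t)) (by fun_prop))
    (ae_of_all _ fun y => (e y).2)]
  congr 1
  have i1 := h.integrable_comp (φ := fun t => Real.negMulLog (1 + t)) (by fun_prop)
  have i2 := h.integrable_comp (φ := fun t => Real.negMulLog (1 + -t)) (by fun_prop)
  have i3 := h.integrable_comp (φ := fun t => Real.negMulLog (1 + (1 - 2 * (q : ℝ)) * t))
    (by fun_prop)
  have i4 : Integrable (fun y => -((1 - q) * Real.negMulLog (1 + s y))) μ := (i1.const_mul _).neg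
  have i5 : Integrable (fun y => -((1 - q) * Real.negMulLog (1 + s y)) -
    q * Real.negMulLog (1 + -s y)) μ := i4.sub (i2.const_mul _)
  rw [integral_add i5 i3, integral_sub i4 (i2.const_mul _), integral_neg, integral_const_mul,
    integral_const_mul, h.integral_comp_neg (φ := fun t => Real.negMulLog (1 + t)) (by fun_prop),
    h.integral_negMulLog]
  ring

/-- Here negMulLog (1 + x) ≤ -x, and `s` has mean zero. -/
lemma integral_negMulLog_affine_nonpos (h : W.HasBias μ s T) [IsProbabilityMeasure μ] {c : ℝ}
    (hc : |c| ≤ 1) : ∫ y, Real.negMulLog (1 + c * s y) ∂μ ≤ 0 := by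
  have i1 := h.integrable_comp (φ := fun t => Real.negMulLog (1 + c * t)) (by fun_prop)
  have i2 := h.integrable_comp (φ := fun t => -c * t) (by fun_prop)
  calc _ ≤ ∫ y, -c * s y ∂μ := by
        refine integral_mono i1 i2 fun y => ?_
        have h0 : 0 ≤ 1 + c * s y := by
          have : |c * s y| ≤ 1 := by
            rw [abs_mul]; exact mul_le_one₀ hc (abs_nonneg _) (h.abs_le y)
          linarith [_root_.abs_le.1 this]
        have := InformationTheory.klFun_nonneg h0
        rw [InformationTheory.klFun_apply] at this
        simp only [Real.negMulLog]
        linarith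
    _ = 0 := by rw [integral_const_mul, h.integral_eq_zero, mul_zero]

lemma capacity_eq (h : W.HasBias μ s T) [IsProbabilityMeasure μ] :
    W.capacity = (∫ y, (Real.log 2 - biasEntropy (s y)) ∂μ) / Real.log 2 := by
  have hM : 0 ≤ ∫ y, (Real.log 2 - biasEntropy (s y)) ∂μ :=
    integral_nonneg fun y => sub_nonneg.2 (biasEntropy_le_log_two _)
  have : ⨆ q, W.mutualInfo q = ENNReal.ofReal (∫ y, (Real.log 2 - biasEntropy (s y)) ∂μ) := by
    apply le_antisymm
    · refine iSup_le fun q => ?_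
      -- For a constant input the output law is that of the input sent, and the mutual information
      -- vanishes.
      rcases q.2.1.eq_or_lt with h0 | h0
      · have : q = 0 := Subtype.ext h0.symm
        subst this
        simp [mutualInfo, outputLaw]
      rcases q.2.2.eq_or_lt with h1 | h1
      · have : q = 1 := Subtype.ext h1
        subst this
        simp [mutualInfo, outputLaw]
      rw [h.mutualInfo_eq h0 h1]
      refine ENNReal.ofReal_le_ofReal ?_
      have := h.integral_negMulLog_affine_nonpos (c := 1 - 2 * q)
        (by rw [_root_.abs_le]; constructor <;> linarith)
      linarith
    -- At uniform input the output law is `μ` itself and the divergence term is zero.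
    · refine le_iSup_of_le ⟨1 / 2, by norm_num, by norm_num⟩ ?_
      rw [h.mutualInfo_eq (by norm_num) (by norm_num)]
      simp
  rw [capacity, this, ENNReal.toReal_ofReal hM]

end MBIOSChannel.HasBias

end Bias

/-! ### The log-likelihood ratio, the bounds on g₁, and the bias of the BSC and the BEC. -/

section LogLikelihood

/-! ### The log-likelihood ratio -/

lemma measurable_tanhHalf : Measurable tanhHalf := by
  refine EReal.measurable_of_measurable_real ?_
  change Measurable fun l : ℝ => Real.tanh (l / 2)
  simp only [Real.tanh_eq_sinh_div_cosh]
  fun_prop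

lemma log_sub_log_ofReal {t : ℝ} (h0 : -1 < t) (h1 : t < 1) :
    ENNReal.log (ENNReal.ofReal ((1 + t) / 2)) - ENNReal.log (ENNReal.ofReal ((1 - t) / 2)) =
      ((Real.log ((1 + t) / (1 - t)) : ℝ) : EReal) := by
  rw [ENNReal.log_ofReal_of_pos (by linarith), ENNReal.log_ofReal_of_pos (by linarith),
    ← EReal.coe_sub, ← Real.log_div (by linarith) (by linarith)]
  congr 2
  have : 1 - t ≠ 0 := by linarith
  field_simp

/-- Since L = ln ((1 + t)/(1 - t)) = 2 artanh t, the bias is tanh(L/2); the values ±1 correspond to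
L = ±∞. -/
lemma tanhHalf_log_sub_log {t : ℝ} (h : |t| ≤ 1) :
    tanhHalf (ENNReal.log (ENNReal.ofReal ((1 + t) / 2)) -
      ENNReal.log (ENNReal.ofReal ((1 - t) / 2))) = t := by
  obtain ⟨h0, h1⟩ := abs_le.1 h
  rcases h0.eq_or_lt with rfl | h0
  · norm_num
    rfl
  rcases h1.eq_or_lt with rfl | h1
  · norm_num
    rfl
  rw [log_sub_log_ofReal h0 h1]
  change Real.tanh (Real.log ((1 + t) / (1 - t)) / 2) = t
  rw [← one_div_mul_eq_div, ← Real.artanh_eq_half_log ⟨h0.le, h1.le⟩, Real.tanh_artanh ⟨h0, h1⟩]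

lemma zero_lt_log_sub_log_iff {t : ℝ} (h : |t| ≤ 1) :
    0 < ENNReal.log (ENNReal.ofReal ((1 + t) / 2)) - ENNReal.log (ENNReal.ofReal ((1 - t) / 2)) ↔
      0 < t := by
  obtain ⟨h0, h1⟩ := abs_le.1 h
  rcases h0.eq_or_lt with rfl | h0
  · norm_num
  rcases h1.eq_or_lt with rfl | h1
  · norm_num
  rw [log_sub_log_ofReal h0 h1, EReal.coe_pos, Real.log_pos_iff (by
    apply div_nonneg <;> linarith), one_lt_div (by linarith)]
  constructor <;> intro <;> linarith

lemma exp_neg_log_sub_log {t : ℝ} (h : |t| ≤ 1) (h' : t ≠ -1) :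
    (EReal.exp (-(ENNReal.log (ENNReal.ofReal ((1 + t) / 2)) -
      ENNReal.log (ENNReal.ofReal ((1 - t) / 2))))).toReal = (1 - t) / (1 + t) := by
  obtain ⟨h0, h1⟩ := abs_le.1 h
  replace h0 := lt_of_le_of_ne h0 h'.symm
  rcases h1.eq_or_lt with rfl | h1
  · norm_num
  rw [log_sub_log_ofReal h0 h1, ← EReal.coe_neg, EReal.exp_coe, ENNReal.toReal_ofReal
    (Real.exp_pos _).le, Real.exp_neg, Real.exp_log (by apply div_pos <;> linarith), inv_div]

namespace MBIOSChannel

variable {𝒴 : Type*} [MeasurableSpace 𝒴] {W : MBIOSChannel 𝒴} {μ : Measure 𝒴} {s : 𝒴 → ℝ}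
  {T : 𝒴 → 𝒴}

lemma measurable_llr (W : MBIOSChannel 𝒴) : Measurable W.llr := by
  have h0 := Measure.measurable_rnDeriv (W.law 0) (W.law 0 + W.law 1)
  have h1 := Measure.measurable_rnDeriv (W.law 1) (W.law 0 + W.law 1)
  unfold llr
  simp only [sub_eq_add_neg]
  fun_prop

namespace HasBias

lemma law_zero_add_law_one (h : W.HasBias μ s T) :
    W.law 0 + W.law 1 = (2 : ℝ≥0∞) • μ := by
  have hs := h.measurable
  rw [h.law_eq, h.law_eq, ← withDensity_add_left (by fun_prop), ← withDensity_const]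
  congr 1
  ext y
  rw [Pi.add_apply, ← ENNReal.ofReal_add (h.one_add_nonneg 0 y) (h.one_add_nonneg 1 y)]
  rw [show 1 + sgn 0 * s y + (1 + sgn 1 * s y) = 2 by simp; ring]
  norm_num

lemma law_eq_withDensity_sum (h : W.HasBias μ s T) (x : ZMod 2) :
    W.law x = (W.law 0 + W.law 1).withDensity fun y => ENNReal.ofReal ((1 + sgn x * s y) / 2) := by
  have hs := h.measurable
  rw [h.law_zero_add_law_one, withDensity_smul_measure, ← withDensity_smul _ (by fun_prop),
    h.law_eq]
  congr 1
  ext y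
  simp only [Pi.smul_apply, smul_eq_mul]
  rw [show (2 : ℝ≥0∞) = ENNReal.ofReal 2 by norm_num, ← ENNReal.ofReal_mul (by norm_num)]
  congr 1; ring

lemma llr_ae (h : W.HasBias μ s T) (x : ZMod 2) : ∀ᵐ y ∂W.law x,
    W.llr y = ENNReal.log (ENNReal.ofReal ((1 + s y) / 2)) -
      ENNReal.log (ENNReal.ofReal ((1 - s y) / 2)) := by
  have hs := h.measurable
  have hd : ∀ x, (W.law x).rnDeriv (W.law 0 + W.law 1) =ᵐ[W.law 0 + W.law 1]
      fun y => ENNReal.ofReal ((1 + sgn x * s y) / 2) := by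
    intro x
    conv_lhs => rw [h.law_eq_withDensity_sum x]
    exact Measure.rnDeriv_withDensity _ (by fun_prop)
  have hac : W.law x ≪ W.law 0 + W.law 1 := by
    rw [h.law_eq_withDensity_sum x]; exact withDensity_absolutelyContinuous _ _
  filter_upwards [hac.ae_le (hd 0), hac.ae_le (hd 1)] with y h0 h1
  rw [llr, h0, h1]
  simp [sub_eq_add_neg]

lemma ae_ne_neg_one (h : W.HasBias μ s T) : ∀ᵐ y ∂W.law 0, s y ≠ -1 := by
  have hs := h.measurable
  rw [h.law_eq, ae_withDensity_iff (by fun_prop)]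
  refine ae_of_all _ fun y hy hy' => hy ?_
  simp [hy']

/-- The cubic term is odd in `s`, hence has mean zero. So g₁, defined under input 0, may be computed
under `μ`. -/
lemma integral_one_add_mul_sq (h : W.HasBias μ s T) [IsProbabilityMeasure μ] :
    ∫ y, (1 + sgn 0 * s y) * s y ^ 2 ∂μ = ∫ y, s y ^ 2 ∂μ := by
  have h3 := h.integral_comp_neg (φ := fun t => t ^ 3) (by fun_prop)
  have : ∀ y, (-s y) ^ 3 = -(s y ^ 3) := fun y => by ring
  simp only [this, integral_neg] at h3
  have e : ∀ y, (1 + sgn 0 * s y) * s y ^ 2 = s y ^ 2 + s y ^ 3 := fun y => by simp; ring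
  simp only [e]
  rw [integral_add (h.integrable_comp (φ := fun t => t ^ 2) (by fun_prop))
    (h.integrable_comp (φ := fun t => t ^ 3) (by fun_prop))]
  linarith

lemma g1_eq (h : W.HasBias μ s T) [IsProbabilityMeasure μ] : W.g1 = ∫ y, s y ^ 2 ∂μ := by
  rw [g1, llrLaw, integral_map W.measurable_llr.aemeasurable
    (measurable_tanhHalf.pow_const 2).aestronglyMeasurable, integral_congr_ae
    (g := fun y => s y ^ 2), h.integral_law, h.integral_one_add_mul_sq]
  filter_upwards [h.llr_ae 0] with y hy
  rw [hy, tanhHalf_log_sub_log (h.abs_le y)]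

/-- For L > 0 one has 1 + e^(-L) = 2/(1 + s), which cancels the density 1 + s of input 0. This
leaves 2s² on s > 0, and symmetry of `s` turns it into s² on the whole space. -/
lemma setIntegral_llrLaw_eq (h : W.HasBias μ s T) [IsProbabilityMeasure μ] :
    ∫ l in Set.Ioi (0 : EReal), (1 + (EReal.exp (-l)).toReal) * tanhHalf l ^ 2 ∂W.llrLaw =
      ∫ y, s y ^ 2 ∂μ := by
  have hm : Measurable fun l : EReal => (1 + (EReal.exp (-l)).toReal) * tanhHalf l ^ 2 := by
    have := measurable_tanhHalf
    fun_prop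
  rw [← integral_indicator measurableSet_Ioi, llrLaw, integral_map W.measurable_llr.aemeasurable
    (hm.indicator measurableSet_Ioi).aestronglyMeasurable, integral_congr_ae
    (g := fun y => if 0 < s y then (1 + (1 - s y) / (1 + s y)) * s y ^ 2 else 0), h.integral_law]
  · let φ : ℝ → ℝ := fun t => if 0 < t then t ^ 2 else 0
    have hφm : Measurable φ := Measurable.ite measurableSet_Ioi (by fun_prop) (by fun_prop)
    have hφi : ∀ g : ℝ → ℝ, Measurable g → (∀ t, |g t| ≤ |t|) →
        Integrable (fun y => φ (g (s y))) μ := fun g hg hgb =>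
      Integrable.of_bound (hφm.comp (hg.comp h.measurable)).aestronglyMeasurable 1
        (ae_of_all _ fun y => by
          have h1 := (hgb (s y)).trans (h.abs_le y)
          have h2 : g (s y) ^ 2 ≤ 1 := (sq_le_one_iff_abs_le_one _).2 h1
          simp only [φ]
          split_ifs
          · rwa [Real.norm_eq_abs, abs_of_nonneg (sq_nonneg _)]
          · simp)
    have e1 : ∀ y, (1 + sgn 0 * s y) *
        (if 0 < s y then (1 + (1 - s y) / (1 + s y)) * s y ^ 2 else 0) = 2 * φ (s y) := by
      intro y
      simp only [φ, sgn_zero, one_mul]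
      split_ifs with hy
      · have : 1 + s y ≠ 0 := by linarith
        field_simp
        ring
      · simp
    have e2 : ∀ y, s y ^ 2 = φ (s y) + φ (-s y) := by
      intro y
      simp only [φ]
      rcases lt_trichotomy (s y) 0 with hy | hy | hy
      · simp [hy, hy.le]
      · simp [hy]
      · simp [hy, hy.le]
    simp only [e1]
    rw [integral_congr_ae (ae_of_all _ e2), integral_add (hφi (fun t => t) measurable_id fun _ => le_rfl)
      (hφi (fun t => -t) measurable_neg fun t => by simp), h.integral_comp_neg hφm,
      integral_const_mul]
    ring
  · filter_upwards [h.llr_ae 0, h.ae_ne_neg_one] with y hy hy'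
    simp only [Set.indicator, Set.mem_Ioi, hy, zero_lt_log_sub_log_iff (h.abs_le y),
      tanhHalf_log_sub_log (h.abs_le y), exp_neg_log_sub_log (h.abs_le y) hy']

/-! ### Bounds on `g₁` -/

lemma biasEntropy_integral (h : W.HasBias μ s T) [IsProbabilityMeasure μ] :
    ∫ y, biasEntropy (s y) ∂μ = (1 - W.capacity) * Real.log 2 := by
  rw [h.capacity_eq, integral_sub (integrable_const _) (h.integrable_comp continuous_biasEntropy)]
  have := log_two_pos.ne'
  simp
  field_simp
  ring

lemma g1_mem (h : W.HasBias μ s T) [IsProbabilityMeasure μ] : W.g1 ∈ Set.Icc (0 : ℝ) 1 := by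
  rw [h.g1_eq]
  refine ⟨integral_nonneg fun y => sq_nonneg _, ?_⟩
  calc ∫ y, s y ^ 2 ∂μ ≤ ∫ _, (1 : ℝ) ∂μ := integral_mono
        (h.integrable_comp (φ := fun t => t ^ 2) (by fun_prop)) (integrable_const _)
        fun y => (sq_le_one_iff_abs_le_one _).2 (h.abs_le y)
    _ = 1 := by simp

lemma capacity_mem (h : W.HasBias μ s T) [IsProbabilityMeasure μ] :
    W.capacity ∈ Set.Icc (0 : ℝ) 1 := by
  have h0 : 0 ≤ ∫ y, biasEntropy (s y) ∂μ := integral_nonneg fun y => biasEntropy_nonneg (h.abs_le y)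
  have h1 : 0 ≤ ∫ y, (Real.log 2 - biasEntropy (s y)) ∂μ :=
    integral_nonneg fun y => sub_nonneg.2 (biasEntropy_le_log_two _)
  rw [h.biasEntropy_integral] at h0
  exact ⟨by rw [h.capacity_eq]; exact div_nonneg h1 log_two_pos.le,
    by linarith [nonneg_of_mul_nonneg_left h0 log_two_pos]⟩

/-- The chord bound of `one_sub_mul_log_two_le` at u = s², integrated over the output. -/
lemma capacity_le_g1 (h : W.HasBias μ s T) [IsProbabilityMeasure μ] : W.capacity ≤ W.g1 := by
  have i2 := h.integrable_comp (φ := fun t => t ^ 2) (by fun_prop)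
  have : (1 - W.g1) * Real.log 2 ≤ (1 - W.capacity) * Real.log 2 := by
    rw [← h.biasEntropy_integral, h.g1_eq]
    calc _ = ∫ y, (1 - s y ^ 2) * Real.log 2 ∂μ := by
          rw [integral_mul_const, integral_sub (integrable_const _) i2]; simp
      _ ≤ _ := integral_mono (((integrable_const _).sub i2).mul_const _)
          (h.integrable_comp continuous_biasEntropy) fun y => by
            simp only
            rw [← biasEntropy_sqrt_sq (s y)]
            exact one_sub_mul_log_two_le (sq_nonneg _)
              ((sq_le_one_iff_abs_le_one _).2 (h.abs_le y))
  linarith [le_of_mul_le_mul_right this log_two_pos]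

/-- Jensen for the concave function u ↦ `biasEntropy (√u)` at u = s². -/
lemma one_sub_capacity_le (h : W.HasBias μ s T) [IsProbabilityMeasure μ] :
    1 - W.capacity ≤ h2 ((1 - Real.sqrt W.g1) / 2) := by
  have i2 := h.integrable_comp (φ := fun t => t ^ 2) (by fun_prop)
  have hi : ∫ y, biasEntropy (Real.sqrt (s y ^ 2)) ∂μ ≤
      biasEntropy (Real.sqrt (∫ y, s y ^ 2 ∂μ)) :=
    concaveOn_biasEntropy_sqrt.le_map_integral
      (continuous_biasEntropy.comp Real.continuous_sqrt).continuousOn isClosed_Icc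
      (ae_of_all _ fun y => ⟨sq_nonneg _, (sq_le_one_iff_abs_le_one _).2 (h.abs_le y)⟩) i2
      (h.integrable_comp (φ := fun t => biasEntropy (Real.sqrt (t ^ 2)))
        (continuous_biasEntropy.comp (Real.continuous_sqrt.comp (continuous_pow 2))))
  simp only [biasEntropy_sqrt_sq] at hi
  rw [h.biasEntropy_integral, ← h.g1_eq] at hi
  rw [h2_eq_biasEntropy, le_div_iff₀ log_two_pos]
  convert! hi using 2
  ring

lemma g1_le (h : W.HasBias μ s T) [IsProbabilityMeasure μ] :
    W.g1 ≤ (1 - 2 * h2Inv (1 - W.capacity)) ^ 2 := by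
  obtain ⟨g0, g1⟩ := h.g1_mem
  have hr0 := Real.sqrt_nonneg W.g1
  have hr1 := Real.sqrt_le_one.2 g1
  have := h2Inv_le (x := (1 - Real.sqrt W.g1) / 2) ⟨by linarith, by linarith⟩ h.one_sub_capacity_le
  rw [← Real.sqrt_le_left (by linarith)]
  linarith

end HasBias

end MBIOSChannel

/-! ### The binary symmetric channel and the binary erasure channel -/

lemma exists_hasBias_bsc (p : unitInterval) : ∃ μ T, IsProbabilityMeasure μ ∧
    (bsc p).HasBias μ (fun y => (1 - 2 * p) * sgn y) T := by
  have hp0 := p.2.1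
  have hp1 := p.2.2
  set μ : Measure (ZMod 2) := (2⁻¹ : ℝ≥0∞) • (Measure.dirac 0 + Measure.dirac 1) with hμ
  have hT : Measurable fun y : ZMod 2 => y + 1 := measurable_of_countable _
  have h1 : (bsc p).law 1 = ((bsc p).law 0).map fun y => y + 1 := by
    simp only [bsc]
    rw [Measure.map_add _ _ hT, Measure.map_smul, Measure.map_smul, Measure.map_dirac' hT,
      Measure.map_dirac' hT]
    rfl
  refine ⟨μ, fun y => y + 1, ⟨?_⟩, MBIOSChannel.HasBias.of_law_zero (measurable_of_countable _)
    (fun y => ?_) ⟨hT, ?_⟩ (fun y => by revert y; decide) (fun y => by simp [sgn_add]) ?_ h1⟩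
  · simp only [hμ, Measure.coe_smul, Measure.coe_add, Pi.smul_apply, Pi.add_apply, measure_univ,
      smul_eq_mul, one_add_one_eq_two]
    exact ENNReal.inv_mul_cancel (by norm_num) (by norm_num)
  · rw [abs_mul, abs_sgn, mul_one, abs_le]
    constructor <;> linarith
  · rw [hμ, Measure.map_smul, Measure.map_add _ _ hT, Measure.map_dirac' hT,
      Measure.map_dirac' hT, add_comm]
    rfl
  · have hm : ∀ A : Set (ZMod 2), MeasurableSet A := fun A => trivial
    have hmf : ∀ f : ZMod 2 → ℝ≥0∞, Measurable f := fun f => measurable_of_countable _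
    ext A -
    rw [withDensity_apply _ (hm A), ← lintegral_indicator (hm A), hμ, lintegral_smul_measure,
      lintegral_add_measure, lintegral_dirac' _ (hmf _), lintegral_dirac' _ (hmf _)]
    simp only [bsc, Measure.coe_add, Measure.coe_smul, Pi.add_apply, Pi.smul_apply, smul_eq_mul,
      Measure.dirac_apply' _ (hm A), Set.indicator, zero_add, Pi.one_apply]
    have e : ∀ a : ℝ, (2⁻¹ : ℝ≥0∞) * ENNReal.ofReal (2 * a) = ENNReal.ofReal a := by
      intro a
      rw [ENNReal.ofReal_mul two_pos.le, ← mul_assoc]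
      simp [ENNReal.inv_mul_cancel]
    rw [mul_add]
    congr 1
    · split_ifs
      · rw [← e, sgn_zero]
        simp only [mul_one]
        congr 2; ring
      · simp
    · split_ifs
      · rw [← e]; simp
      · simp

lemma exists_hasBias_bec (p : unitInterval) : ∃ μ T, IsProbabilityMeasure μ ∧
    μ.real {none} = p ∧ (bec p).HasBias μ (fun y => Option.elim y 0 sgn) T := by
  have hp0 := p.2.1
  have hp1 : 0 ≤ 1 - (p : ℝ) := sub_nonneg.2 p.2.2
  set μ : Measure (Option (ZMod 2)) := (2⁻¹ : ℝ≥0∞) • ((bec p).law 0 + (bec p).law 1) with hμ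
  have hT : Measurable (Option.map fun x : ZMod 2 => x + 1) := Measurable.of_discrete
  have h1 : (bec p).law 1 = ((bec p).law 0).map (Option.map fun x : ZMod 2 => x + 1) := by
    simp only [bec]
    rw [Measure.map_add _ _ hT, Measure.map_smul, Measure.map_smul, Measure.map_dirac' hT,
      Measure.map_dirac' hT]
    rfl
  have hinv : Function.Involutive (Option.map fun x : ZMod 2 => x + 1) := fun y => by
    revert y; decide
  have h0 : (bec p).law 0 = ((bec p).law 1).map (Option.map fun x : ZMod 2 => x + 1) := by
    rw [h1, Measure.map_map hT hT, hinv.comp_self, Measure.map_id]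
  refine ⟨μ, Option.map fun x => x + 1, ⟨?_⟩, ?_, MBIOSChannel.HasBias.of_law_zero
    Measurable.of_discrete (fun y => ?_) ⟨hT, ?_⟩ hinv (fun y => ?_) ?_ h1⟩
  · simp only [hμ, Measure.coe_smul, Measure.coe_add, Pi.smul_apply, Pi.add_apply, measure_univ,
      smul_eq_mul, one_add_one_eq_two]
    exact ENNReal.inv_mul_cancel (by norm_num) (by norm_num)
  · simp only [Measure.real, hμ, bec, Measure.coe_smul, Measure.coe_add, Pi.smul_apply,
      Pi.add_apply, smul_eq_mul, Measure.dirac_apply' _ (MeasurableSet.singleton none)]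
    simp
    rw [← ENNReal.ofReal_add hp0 hp0, ENNReal.toReal_ofReal (by linarith)]
    ring
  · cases y with
    | none => simp
    | some b => simp [abs_sgn]
  · rw [hμ, Measure.map_smul, Measure.map_add _ _ hT, ← h0, ← h1, add_comm]
  · cases y with
    | none => simp
    | some b => simp [sgn_add]
  · have hm : ∀ A : Set (Option (ZMod 2)), MeasurableSet A := fun A => trivial
    have hmf : ∀ f : Option (ZMod 2) → ℝ≥0∞, Measurable f := fun f => Measurable.of_discrete
    ext A -
    rw [withDensity_apply _ (hm A), ← lintegral_indicator (hm A), hμ]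
    simp only [bec, lintegral_smul_measure,
      lintegral_add_measure, lintegral_dirac' _ (hmf _), Measure.coe_add, Measure.coe_smul,
      Pi.add_apply, Pi.smul_apply, smul_eq_mul,
      Measure.dirac_apply' _ (hm A), Set.indicator, Pi.one_apply, Option.elim]
    have e : (2⁻¹ : ℝ≥0∞) * 2 = 1 := ENNReal.inv_mul_cancel (by norm_num) (by norm_num)
    have e2 : ENNReal.ofReal (1 + 1) = 2 := by norm_num
    simp only [sgn_zero, sgn_one, e2, add_zero, add_neg_cancel, ENNReal.ofReal_zero,
      ENNReal.ofReal_one, ite_self, mul_zero, zero_add]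
    classical
    calc _ = 2⁻¹ * 2 * (ENNReal.ofReal (1 - p) * (if some 0 ∈ A then 1 else 0) +
        ENNReal.ofReal p * (if none ∈ A then 1 else 0)) := by rw [e, one_mul]
      _ = _ := by split_ifs <;> ring

end LogLikelihood

/-! ### Product channels and the lower bound on the equivocation. -/

section IndependentUses

/-! ### Independent uses of a channel -/

lemma card_codewords_pos {n : ℕ} {𝒞 : Submodule (ZMod 2) (Fin n → ZMod 2)}
    [DecidablePred (· ∈ 𝒞)] : (0 : ℝ) < ({x | x ∈ 𝒞} : Finset (Fin n → ZMod 2)).card := by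
  exact_mod_cast Finset.card_pos.2 ⟨0, by simp [𝒞.zero_mem]⟩

lemma avgProb_eq {𝒴 : Type*} [MeasurableSpace 𝒴] {n : ℕ} {𝒵 : Type*} [MeasurableSpace 𝒵]
    (𝒞 : Submodule (ZMod 2) (Fin n → ZMod 2)) [DecidablePred (· ∈ 𝒞)] (J : Finset (Fin n))
    (W : MBIOSChannel 𝒴) (D : Kernel (Fin n → 𝒴) 𝒵) (E : (Fin n → ZMod 2) → Fin n → Set 𝒵) :
    avgProb 𝒞 J W D E = (∑ i ∈ J, (∑ x with x ∈ 𝒞, (decodedLaw W D x).real (E x i)) /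
      ({x | x ∈ 𝒞} : Finset (Fin n → ZMod 2)).card) / J.card := by
  have hc : Nat.card 𝒞 = ({x | x ∈ 𝒞} : Finset (Fin n → ZMod 2)).card := by
    rw [Nat.card_eq_fintype_card, Fintype.card_subtype]
  unfold avgProb
  rw [hc, ← Finset.sum_div, div_right_comm, Finset.sum_comm, ← Finset.sum_div]
  congr!

lemma integrable_of_abs_le {Ω : Type*} [MeasurableSpace Ω] {M : Measure Ω} [IsFiniteMeasure M]
    {f : Ω → ℝ} (hf : Measurable f) (C : ℝ) (hC : ∀ y, |f y| ≤ C) : Integrable f M :=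
  Integrable.of_bound hf.aestronglyMeasurable C (ae_of_all _ hC)

namespace MBIOSChannel.HasBias

variable {𝒴 : Type*} [MeasurableSpace 𝒴] {W : MBIOSChannel 𝒴} {μ : Measure 𝒴} {s : 𝒴 → ℝ}
  {T : 𝒴 → 𝒴} {n m : ℕ}

lemma measurable_comp_pi (h : W.HasBias μ s T) {φ : (Fin n → ℝ) → ℝ} (hφ : Continuous φ) :
    Measurable fun y : Fin n → 𝒴 => φ fun i => s (y i) := by
  have hs := h.measurable
  exact hφ.measurable.comp (measurable_pi_lambda _ fun i => hs.comp (measurable_pi_apply i))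

lemma exists_bound_comp_pi (h : W.HasBias μ s T) {φ : (Fin n → ℝ) → ℝ} (hφ : Continuous φ) :
    ∃ C, ∀ y : Fin n → 𝒴, |φ fun i => s (y i)| ≤ C := by
  obtain ⟨C, hC⟩ := (isCompact_univ_pi fun _ : Fin n =>
    isCompact_Icc (a := (-1 : ℝ)) (b := 1)).exists_bound_of_continuousOn hφ.continuousOn
  exact ⟨C, fun y => hC _ fun i _ => _root_.abs_le.1 (h.abs_le (y i))⟩

lemma integrable_comp_pi [IsFiniteMeasure μ] (h : W.HasBias μ s T) {φ : (Fin n → ℝ) → ℝ}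
    (hφ : Continuous φ) :
    Integrable (fun y : Fin n → 𝒴 => φ fun i => s (y i)) (Measure.pi fun _ => μ) := by
  obtain ⟨C, hC⟩ := h.exists_bound_comp_pi hφ
  exact integrable_of_abs_le (h.measurable_comp_pi hφ) C hC

lemma _root_.TannerBound.continuous_likelihood (x : Fin n → ZMod 2) : Continuous (likelihood x) := by
  unfold likelihood; fun_prop

lemma _root_.TannerBound.continuous_weightedEntropy (S : Finset (Fin n → ZMod 2)) :
    Continuous (weightedEntropy S) := by
  have := continuous_likelihood (n := n)
  unfold weightedEntropy
  fun_prop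

lemma pi_law_eq (h : W.HasBias μ s T) [IsProbabilityMeasure μ] (x : Fin n → ZMod 2) :
    Measure.pi (fun i => W.law (x i)) = (Measure.pi fun _ => μ).withDensity
      fun y => ENNReal.ofReal (likelihood x fun i => s (y i)) := by
  have hs := h.measurable
  refine Measure.pi_eq fun A hA => ?_
  have hnn : ∀ y : Fin n → 𝒴, 0 ≤ likelihood x fun i => s (y i) := fun y =>
    likelihood_nonneg (fun i => h.abs_le _) x
  rw [withDensity_apply _ (MeasurableSet.univ_pi hA), ← ofReal_integral_eq_lintegral_ofReal
    (h.integrable_comp_pi (continuous_likelihood x)).integrableOn (ae_of_all _ hnn),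
    Measure.restrict_pi_pi]
  unfold likelihood
  rw [integral_fintype_prod_eq_prod (fun i y => 1 + sgn (x i) * s y), ENNReal.ofReal_prod_of_nonneg
    fun i _ => integral_nonneg fun y => h.one_add_nonneg _ _]
  refine Finset.prod_congr rfl fun i _ => ?_
  rw [h.law_eq, withDensity_apply _ (hA i), ofReal_integral_eq_lintegral_ofReal
    (h.integrable_comp (φ := fun t => 1 + sgn (x i) * t) (by fun_prop)).integrableOn
    (ae_of_all _ (h.one_add_nonneg _))]

lemma integral_pi_law (h : W.HasBias μ s T) [IsProbabilityMeasure μ] (x : Fin n → ZMod 2)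
    (f : (Fin n → 𝒴) → ℝ) :
    ∫ y, f y ∂Measure.pi (fun i => W.law (x i)) =
      ∫ y, likelihood x (fun i => s (y i)) * f y ∂Measure.pi fun _ => μ := by
  rw [h.pi_law_eq, integral_withDensity_eq_integral_toReal_smul
    (h.measurable_comp_pi (continuous_likelihood x)).ennreal_ofReal (by simp)]
  simp only [ENNReal.toReal_ofReal (likelihood_nonneg (fun i => h.abs_le _) x), smul_eq_mul]

lemma integral_likelihood (h : W.HasBias μ s T) [IsProbabilityMeasure μ] (x : Fin n → ZMod 2) :
    ∫ y, likelihood x (fun i => s (y i)) ∂Measure.pi (fun _ => μ) = 1 := by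
  have := h.integral_pi_law x fun _ => 1
  simpa using this.symm

lemma decodedLaw_real (h : W.HasBias μ s T) [IsProbabilityMeasure μ] {𝒵 : Type*}
    [MeasurableSpace 𝒵] (D : Kernel (Fin n → 𝒴) 𝒵) [IsMarkovKernel D] (x : Fin n → ZMod 2)
    {E : Set 𝒵} (hE : MeasurableSet E) :
    (decodedLaw W D x).real E =
      ∫ y, likelihood x (fun i => s (y i)) * (D y).real E ∂Measure.pi fun _ => μ := by
  rw [← h.integral_pi_law, decodedLaw, Measure.real, Measure.bind_apply hE D.measurable.aemeasurable,
    ← integral_toReal (D.measurable_coe hE).aemeasurable (ae_of_all _ fun y => measure_lt_top _ _)]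
  rfl

/-- Applying `T` in the coordinates where `w` is nonzero preserves the product measure and flips
exactly those biases. -/
lemma integral_sgn_mul (h : W.HasBias μ s T) [IsProbabilityMeasure μ] (w : Fin n → ZMod 2)
    {φ : (Fin n → ℝ) → ℝ} (hφ : Continuous φ) :
    ∫ y, φ (fun i => sgn (w i) * s (y i)) ∂Measure.pi (fun _ => μ) =
      ∫ y, φ (fun i => s (y i)) ∂Measure.pi fun _ => μ := by
  have hmp : MeasurePreserving (fun (y : Fin n → 𝒴) i => (if w i = 0 then id else T) (y i))
      (Measure.pi fun _ => μ) (Measure.pi fun _ => μ) := by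
    refine measurePreserving_pi (fun _ => μ) (fun _ => μ)
      (f := fun i => if w i = 0 then id else T) fun i => ?_
    split_ifs
    · exact MeasurePreserving.id μ
    · exact h.measurePreserving
  have := integral_map hmp.aemeasurable (f := fun y => φ fun i => s (y i))
    (h.measurable_comp_pi hφ).aestronglyMeasurable
  rw [hmp.map_eq] at this
  rw [this]
  refine integral_congr_ae (ae_of_all _ fun y => ?_)
  simp only
  congr 1
  ext i
  unfold sgn
  split_ifs
  · simp
  · simp [h.anti]

lemma integral_eval (h : W.HasBias μ s T) [IsProbabilityMeasure μ] (i : Fin n) {φ : ℝ → ℝ}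
    (hφ : Continuous φ) :
    ∫ y, φ (s (y i)) ∂Measure.pi (fun _ : Fin n => μ) = ∫ y, φ (s y) ∂μ := by
  have hmp := measurePreserving_eval (fun _ : Fin n => μ) i
  have hm : Measurable fun y => φ (s y) := hφ.measurable.comp h.measurable
  have := integral_map hmp.aemeasurable hm.aestronglyMeasurable
  rw [hmp.map_eq] at this
  exact this.symm

/-- A lower bound on the equivocation of the codeword given the channel output. -/
lemma le_integral_weightedEntropy (h : W.HasBias μ s T) [IsProbabilityMeasure μ]
    {𝒞 : Submodule (ZMod 2) (Fin n → ZMod 2)} [DecidablePred (· ∈ 𝒞)]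
    {H : Matrix (Fin m) (Fin n) (ZMod 2)} (hH : IsFullRankParityCheck H 𝒞) :
    n * ((1 - W.capacity) * Real.log 2) - ∑ j, ∫ y : Fin n → 𝒴,
      biasEntropy (∏ i with H j i ≠ 0, s (y i)) ∂Measure.pi (fun _ => μ) ≤
    ∫ y, weightedEntropy {x | x ∈ 𝒞} (fun i => s (y i)) ∂Measure.pi fun _ => μ := by
  have hbe := continuous_biasEntropy
  have hw := continuous_weightedEntropy (n := n) {x | x ∈ 𝒞}
  have i1 : ∀ i : Fin n, Integrable (fun y : Fin n → 𝒴 => biasEntropy (s (y i)))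
      (Measure.pi fun _ => μ) := fun i =>
    h.integrable_comp_pi (φ := fun t => biasEntropy (t i)) (by fun_prop)
  have i2 : ∀ j : Fin m, Integrable (fun y : Fin n → 𝒴 =>
      biasEntropy (∏ i with H j i ≠ 0, s (y i))) (Measure.pi fun _ => μ) := fun j =>
    h.integrable_comp_pi (φ := fun t => biasEntropy (∏ i with H j i ≠ 0, t i)) (by fun_prop)
  have i3 : ∀ w : Fin n → ZMod 2, Integrable (fun y : Fin n → 𝒴 =>
      weightedEntropy {x | x ∈ 𝒞} (fun i => sgn (w i) * s (y i))) (Measure.pi fun _ => μ) :=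
    fun w => h.integrable_comp_pi
      (φ := fun t => weightedEntropy {x | x ∈ 𝒞} (fun i => sgn (w i) * t i))
      (hw.comp (by fun_prop))
  have key := integral_mono (((integrable_finsetSum Finset.univ fun i _ => i1 i).sub
    (integrable_finsetSum Finset.univ fun j _ => i2 j)).const_mul (2 ^ n : ℝ))
    (integrable_finsetSum Finset.univ fun w _ => i3 w) fun y =>
      le_sum_weightedEntropy hH (t := fun i => s (y i)) fun i => h.abs_le _
  rw [integral_const_mul, integral_sub' (integrable_finsetSum Finset.univ fun i _ => i1 i)
    (integrable_finsetSum Finset.univ fun j _ => i2 j), integral_finsetSum _ fun i _ => i1 i,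
    integral_finsetSum _ fun j _ => i2 j, integral_finsetSum _ fun w _ => i3 w] at key
  -- All 2^n sign patterns have the same integral, so the factor 2^n cancels at the end.
  simp only [h.integral_sgn_mul _ hw, h.integral_eval _ hbe, h.biasEntropy_integral] at key
  simp only [Finset.sum_const, Finset.card_univ, Fintype.card_fun, Fintype.card_fin, ZMod.card,
    nsmul_eq_mul] at key
  push_cast at key
  exact le_of_mul_le_mul_left key (by positivity)

lemma integral_prod_sq (h : W.HasBias μ s T) [IsProbabilityMeasure μ] (S : Finset (Fin n)) :
    ∫ y : Fin n → 𝒴, (∏ i ∈ S, s (y i)) ^ 2 ∂Measure.pi (fun _ => μ) = W.g1 ^ S.card := by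
  have := integral_fintype_prod_eq_prod (𝕜 := ℝ) (μ := fun _ : Fin n => μ)
    (fun i y => if i ∈ S then s y ^ 2 else 1)
  simp only [Finset.prod_ite_mem, Finset.univ_inter] at this
  simp only [← Finset.prod_pow]
  rw [this, h.g1_eq, ← Finset.prod_const]
  rw [← Finset.prod_subset S.subset_univ]
  · exact Finset.prod_congr rfl fun i hi => by simp [hi]
  · intro i _ hi
    simp [hi]

lemma abs_prod_le (h : W.HasBias μ s T) (S : Finset (Fin n)) (y : Fin n → 𝒴) :
    |∏ i ∈ S, s (y i)| ≤ 1 := by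
  rw [Finset.abs_prod]
  exact Finset.prod_le_one (fun i _ => abs_nonneg _) fun i _ => h.abs_le _

/-- Jensen in the squared product, whose mean is a power of g₁ by independence. -/
lemma integral_biasEntropy_prod_le (h : W.HasBias μ s T) [IsProbabilityMeasure μ]
    (S : Finset (Fin n)) :
    ∫ y : Fin n → 𝒴, biasEntropy (∏ i ∈ S, s (y i)) ∂Measure.pi (fun _ => μ) ≤
      biasEntropy (Real.sqrt (W.g1 ^ S.card)) := by
  have hbe := continuous_biasEntropy
  rw [← h.integral_prod_sq]
  have : ∫ y : Fin n → 𝒴, biasEntropy (Real.sqrt ((∏ i ∈ S, s (y i)) ^ 2))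
      ∂Measure.pi (fun _ => μ) ≤ _ := concaveOn_biasEntropy_sqrt.le_map_integral
    (continuous_biasEntropy.comp Real.continuous_sqrt).continuousOn isClosed_Icc
    (ae_of_all _ fun y : Fin n → 𝒴 => ⟨sq_nonneg (∏ i ∈ S, s (y i)),
      (sq_le_one_iff_abs_le_one _).2 (h.abs_prod_le S y)⟩)
    (h.integrable_comp_pi (φ := fun t => (∏ i ∈ S, t i) ^ 2) (by fun_prop))
    (h.integrable_comp_pi (φ := fun t => biasEntropy (Real.sqrt ((∏ i ∈ S, t i) ^ 2)))
      (by fun_prop))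
  simpa only [biasEntropy_sqrt_sq] using this

end MBIOSChannel.HasBias

end IndependentUses

/-! ### Upper bounds on the equivocation from the performance of a decoder. -/

section Equivocation

lemma DeterminedBy.eq_of_forall {n : ℕ} {𝒞 : Submodule (ZMod 2) (Fin n → ZMod 2)}
    {J : Finset (Fin n)} (hJ : DeterminedBy 𝒞 J) {x y : Fin n → ZMod 2} (hx : x ∈ 𝒞) (hy : y ∈ 𝒞)
    (h : ∀ i ∈ J, x i = y i) : x = y :=
  sub_eq_zero.1 (hJ _ (𝒞.sub_mem hx hy) fun i hi => by simp [h i hi])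

namespace MBIOSChannel.HasBias

variable {𝒴 : Type*} [MeasurableSpace 𝒴] {W : MBIOSChannel 𝒴} {μ : Measure 𝒴} {s : 𝒴 → ℝ}
  {T : 𝒴 → 𝒴} {n m : ℕ}

/-- **Jensen's inequality** for the entropy of an error whose probability depends on the
output. -/
lemma _root_.TannerBound.integral_mul_binEntropy_le {Ω : Type*} [MeasurableSpace Ω] {M : Measure Ω}
    [IsProbabilityMeasure M] {A e : Ω → ℝ} (hA : Measurable A) (he : Measurable e)
    (he0 : ∀ y, 0 ≤ e y) (heA : ∀ y, e y ≤ A y) (hA1 : ∫ y, A y ∂M = 1) :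
    ∫ y, A y * Real.binEntropy (e y / A y) ∂M ≤ Real.binEntropy (∫ y, e y ∂M) := by
  have hA0 : ∀ y, 0 ≤ A y := fun y => (he0 y).trans (heA y)
  have hAi : Integrable A M := by
    by_contra hn
    rw [integral_undef hn] at hA1
    exact zero_ne_one hA1
  -- Under the output law `Q`, the quotient e / A is a conditional error probability, and its mean
  -- is ∫ e dM.
  set Q := M.withDensity fun y => ENNReal.ofReal (A y) with hQ
  have hQp : IsProbabilityMeasure Q := ⟨by
    rw [hQ, withDensity_apply _ MeasurableSet.univ, setLIntegral_univ,
      ← ofReal_integral_eq_lintegral_ofReal hAi (ae_of_all _ hA0), hA1, ENNReal.ofReal_one]⟩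
  have hint : ∀ f : Ω → ℝ, ∫ y, f y ∂Q = ∫ y, A y * f y ∂M := by
    intro f
    rw [hQ, integral_withDensity_eq_integral_toReal_smul (by fun_prop) (by simp)]
    simp only [ENNReal.toReal_ofReal (hA0 _), smul_eq_mul]
  have hmem : ∀ y, e y / A y ∈ Set.Icc (0 : ℝ) 1 := fun y =>
    ⟨div_nonneg (he0 y) (hA0 y), div_le_one_of_le₀ (heA y) (hA0 y)⟩
  have hb : Measurable Real.binEntropy := Real.binEntropy_continuous.measurable
  have key := Real.strictConcave_binEntropy.concaveOn.le_map_integral (μ := Q)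
    (f := fun y => e y / A y) Real.binEntropy_continuous.continuousOn isClosed_Icc
    (ae_of_all _ hmem)
    (integrable_of_abs_le (by fun_prop) 1 fun y => by
      rw [abs_of_nonneg (hmem y).1]; exact (hmem y).2)
    (integrable_of_abs_le (hb.comp (by fun_prop)) (Real.log 2) fun y => by
      rw [Function.comp_apply, abs_of_nonneg (Real.binEntropy_nonneg (hmem y).1 (hmem y).2)]
      exact Real.binEntropy_le_log_two)
  rw [hint, hint] at key
  refine key.trans_eq (congr_arg _ (integral_congr_ae (ae_of_all _ fun y => ?_)))
  simp only
  rcases (hA0 y).eq_or_lt with h0 | h0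
  · have : e y = 0 := le_antisymm (h0 ▸ heA y) (he0 y)
    simp [this]
  · exact mul_div_cancel₀ _ h0.ne'

lemma measurable_likelihood (h : W.HasBias μ s T) (x : Fin n → ZMod 2) :
    Measurable fun y : Fin n → 𝒴 => likelihood x fun i => s (y i) :=
  h.measurable_comp_pi (continuous_likelihood x)

lemma integrable_likelihood_mul (h : W.HasBias μ s T) [IsProbabilityMeasure μ]
    (x : Fin n → ZMod 2) {f : (Fin n → 𝒴) → ℝ} (hf : Measurable f) (hf1 : ∀ y, |f y| ≤ 1) :
    Integrable (fun y => likelihood x (fun i => s (y i)) * f y) (Measure.pi fun _ => μ) := by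
  obtain ⟨C, hC⟩ := h.exists_bound_comp_pi (continuous_likelihood x)
  refine integrable_of_abs_le ((h.measurable_likelihood x).mul hf) C fun y => ?_
  rw [abs_mul]
  exact (mul_le_of_le_one_right (abs_nonneg _) (hf1 y)).trans (hC y)

lemma _root_.TannerBound.measurable_kernel_real {α 𝒵 : Type*} [MeasurableSpace α] [MeasurableSpace 𝒵]
    (D : Kernel α 𝒵) {E : Set 𝒵} (hE : MeasurableSet E) : Measurable fun y => (D y).real E :=
  (D.measurable_coe hE).ennreal_toReal

open Finset in
/-- **Fano's inequality**: the equivocation is bounded by the entropies of the bit errors. -/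
lemma integral_weightedEntropy_le_error (h : W.HasBias μ s T) [IsProbabilityMeasure μ]
    {𝒞 : Submodule (ZMod 2) (Fin n → ZMod 2)} [DecidablePred (· ∈ 𝒞)] {J : Finset (Fin n)}
    (hJ : DeterminedBy 𝒞 J) (hJ0 : J.Nonempty) (D : Kernel (Fin n → 𝒴) (Fin n → ZMod 2))
    [IsMarkovKernel D] :
    bitErrorProb 𝒞 J W D ∈ Set.Icc (0 : ℝ) 1 ∧
    ∫ y, weightedEntropy {x | x ∈ 𝒞} (fun i => s (y i)) ∂Measure.pi (fun _ => μ) ≤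
      #J * Real.binEntropy (bitErrorProb 𝒞 J W D) := by
  set S : Finset (Fin n → ZMod 2) := {x | x ∈ 𝒞} with hS
  have hK : (0 : ℝ) < #S := card_codewords_pos
  have hJc : (0 : ℝ) < #J := by exact_mod_cast card_pos.2 hJ0
  set M : Measure (Fin n → 𝒴) := Measure.pi fun _ => μ with hM
  set E : Fin n → ZMod 2 → Set (Fin n → ZMod 2) := fun i b => {z | z i ≠ b} with hE
  have hEm : ∀ i b, MeasurableSet (E i b) := fun i b => by
    have hm : Measurable fun z : Fin n → ZMod 2 => z i := measurable_pi_apply i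
    exact hm (MeasurableSet.of_discrete (s := {b}ᶜ))
  -- The estimate is a bit, so it errs on exactly one of the values 0 and 1; the two error
  -- probabilities therefore sum to 1.
  have hEc : ∀ i, E i 1 = (E i 0)ᶜ := fun i => by
    ext z
    rcases zmod_two_cases (z i) with hz | hz <;> simp [hE, hz]
  set a : (Fin n → ZMod 2) → (Fin n → 𝒴) → ℝ := fun x y => likelihood x fun i => s (y i) with ha
  have ha0 : ∀ x y, 0 ≤ a x y := fun x y => likelihood_nonneg (fun i => h.abs_le _) x
  have ham : ∀ x, Measurable (a x) := h.measurable_likelihood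
  -- `A` is the density of the received word for a uniform codeword, and `e i` the part of it on
  -- which bit `i` is decoded wrongly.
  set e : Fin n → (Fin n → 𝒴) → ℝ := fun i y => (∑ x ∈ S, a x y * (D y).real (E i (x i))) / #S
    with he
  set A : (Fin n → 𝒴) → ℝ := fun y => (∑ x ∈ S, a x y) / #S with hA
  have hDm : ∀ i b, Measurable fun y => (D y).real (E i b) := fun i b =>
    measurable_kernel_real D (hEm i b)
  have hAm : Measurable A := (Finset.measurable_fun_sum _ fun x _ => ham x).div_const _
  have hem : ∀ i, Measurable (e i) := fun i =>
    (Finset.measurable_fun_sum _ fun x _ => (ham x).mul (hDm i (x i))).div_const _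
  have he0 : ∀ i y, 0 ≤ e i y := fun i y =>
    div_nonneg (sum_nonneg fun x _ => mul_nonneg (ha0 x y) measureReal_nonneg) hK.le
  have heA : ∀ i y, e i y ≤ A y := fun i y => div_le_div_of_nonneg_right
    (sum_le_sum fun x _ => mul_le_of_le_one_right (ha0 x y) measureReal_le_one) hK.le
  have hai : ∀ x, Integrable (a x) M := fun x => h.integrable_comp_pi (continuous_likelihood x)
  have hA1 : ∫ y, A y ∂M = 1 := by
    rw [integral_div, integral_finsetSum _ fun x _ => hai x,
      sum_congr rfl fun x _ => h.integral_likelihood x, sum_const, nsmul_eq_mul, mul_one,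
      div_self hK.ne']
  have hAi : Integrable A M := (integrable_finsetSum _ fun x _ => hai x).div_const _
  set P : Fin n → ℝ := fun i => ∫ y, e i y ∂M with hP
  have hPe : bitErrorProb 𝒞 J W D = (∑ i ∈ J, P i) / #J := by
    rw [bitErrorProb, avgProb_eq]
    congr 1
    refine sum_congr rfl fun i _ => ?_
    rw [hP]
    simp only [he]
    rw [integral_div, integral_finsetSum _ fun x _ => h.integrable_likelihood_mul x (hDm i (x i))
      fun y => by rw [abs_of_nonneg measureReal_nonneg]; exact measureReal_le_one]
    congr 1
    exact sum_congr rfl fun x _ => h.decodedLaw_real D x (hEm i (x i))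
  have hei : ∀ i, Integrable (e i) M := fun i =>
    hAi.mono' (hem i).aestronglyMeasurable (ae_of_all _ fun y => by
      rw [Real.norm_eq_abs, abs_of_nonneg (he0 i y)]; exact heA i y)
  have hPm : ∀ i, P i ∈ Set.Icc (0 : ℝ) 1 := fun i =>
    ⟨integral_nonneg (he0 i), hA1 ▸ integral_mono (hei i) hAi (heA i)⟩
  have hw : ∑ _i ∈ J, (#J : ℝ)⁻¹ = 1 := by
    rw [sum_const, nsmul_eq_mul, mul_inv_cancel₀ hJc.ne']
  have hPavg : (∑ i ∈ J, P i) / #J = ∑ i ∈ J, (#J : ℝ)⁻¹ • P i := by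
    rw [← smul_sum, smul_eq_mul, div_eq_inv_mul]
  have hjensen := Real.strictConcave_binEntropy.concaveOn.le_map_sum (t := J)
    (w := fun _ => (#J : ℝ)⁻¹) (p := P) (fun _ _ => inv_nonneg.2 hJc.le) hw fun i _ => hPm i
  refine ⟨?_, ?_⟩
  · rw [hPe, hPavg]
    exact (convex_Icc (0 : ℝ) 1).sum_mem (fun _ _ => inv_nonneg.2 hJc.le) hw fun i _ => hPm i
  have hfano : ∀ y, weightedEntropy S (fun i => s (y i)) ≤
      ∑ i ∈ J, A y * Real.binEntropy (e i y / A y) := by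
    intro y
    refine (weightedEntropy_le (fun x hx x' hx' => hJ.eq_of_forall (by simpa [hS] using hx)
      (by simpa [hS] using hx')) fun i => h.abs_le (y i)).trans ?_
    rw [sum_div]
    refine sum_le_sum fun i _ => ?_
    have := binEntropy_le_binEntropy_error S (fun x => a x y) (fun x _ => ha0 x y) (fun x => x i)
      (fun b => (D y).real (E i b)) (fun _ => measureReal_nonneg) (by
        rw [hEc, probReal_compl_eq_one_sub (hEm i 0)]; ring)
    have h2 : e i y / A y = (∑ x ∈ S, a x y * (D y).real (E i (x i))) / ∑ x ∈ S, a x y := by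
      simp only [he, hA]
      rw [div_div_div_cancel_right₀ hK.ne']
    rw [h2]
    simp only [hA]
    rw [div_mul_eq_mul_div]
    exact div_le_div_of_nonneg_right this hK.le
  have hbm : Measurable Real.binEntropy := Real.binEntropy_continuous.measurable
  have hbi : ∀ i, Integrable (fun y => A y * Real.binEntropy (e i y / A y)) M := fun i =>
    (hAi.mul_const (Real.log 2)).mono'
      (hAm.mul (hbm.comp ((hem i).div hAm))).aestronglyMeasurable (ae_of_all _ fun y => by
        have hA0 := (he0 i y).trans (heA i y)
        rw [Real.norm_eq_abs, abs_of_nonneg (mul_nonneg hA0 (Real.binEntropy_nonneg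
          (div_nonneg (he0 i y) hA0) (div_le_one_of_le₀ (heA i y) hA0)))]
        exact mul_le_mul_of_nonneg_left Real.binEntropy_le_log_two hA0)
  calc _ ≤ ∫ y, ∑ i ∈ J, A y * Real.binEntropy (e i y / A y) ∂M :=
        integral_mono (h.integrable_comp_pi (continuous_weightedEntropy S))
          (integrable_finsetSum _ fun i _ => hbi i) hfano
    _ = ∑ i ∈ J, ∫ y, A y * Real.binEntropy (e i y / A y) ∂M := integral_finsetSum _ fun i _ => hbi i
    _ ≤ ∑ i ∈ J, Real.binEntropy (P i) := sum_le_sum fun i _ =>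
        integral_mul_binEntropy_le hAm (hem i) (he0 i) (heA i) hA1
    _ = #J * ∑ i ∈ J, (#J : ℝ)⁻¹ • Real.binEntropy (P i) := by
        rw [← smul_sum, smul_eq_mul, mul_inv_cancel_left₀ hJc.ne']
    _ ≤ _ := by
        rw [hPe, hPavg]
        exact mul_le_mul_of_nonneg_left hjensen hJc.le

open Finset in
/-- The equivocation is bounded by the erasure probabilities of a decoder which makes no undetected
errors. -/
lemma integral_weightedEntropy_le_erasure (h : W.HasBias μ s T) [IsProbabilityMeasure μ]
    {𝒞 : Submodule (ZMod 2) (Fin n → ZMod 2)} [DecidablePred (· ∈ 𝒞)] {J : Finset (Fin n)}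
    (hJ : DeterminedBy 𝒞 J) (hJ0 : J.Nonempty) (D : Kernel (Fin n → 𝒴) (Fin n → Option (ZMod 2)))
    [IsMarkovKernel D] (hD : IsErasureDecoder 𝒞 J W D) :
    0 ≤ bitErasureProb 𝒞 J W D ∧
    ∫ y, weightedEntropy {x | x ∈ 𝒞} (fun i => s (y i)) ∂Measure.pi (fun _ => μ) ≤
      #J * (bitErasureProb 𝒞 J W D * Real.log 2) := by
  set S : Finset (Fin n → ZMod 2) := {x | x ∈ 𝒞} with hS
  have hK : (0 : ℝ) < #S := card_codewords_pos
  have hJc : (0 : ℝ) < #J := by exact_mod_cast card_pos.2 hJ0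
  set M : Measure (Fin n → 𝒴) := Measure.pi fun _ => μ with hM
  set E : Fin n → Set (Fin n → Option (ZMod 2)) := fun i => {z | z i = none} with hE
  have hEm : ∀ i, MeasurableSet (E i) := fun i => by
    have hm : Measurable fun z : Fin n → Option (ZMod 2) => z i := measurable_pi_apply i
    exact hm (MeasurableSet.of_discrete (s := {none}))
  set a : (Fin n → ZMod 2) → (Fin n → 𝒴) → ℝ := fun x y => likelihood x fun i => s (y i) with ha
  have ha0 : ∀ x y, 0 ≤ a x y := fun x y => likelihood_nonneg (fun i => h.abs_le _) x
  have ham : ∀ x, Measurable (a x) := h.measurable_likelihood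
  have hDm : ∀ i, Measurable fun y => (D y).real (E i) := fun i => measurable_kernel_real D (hEm i)
  have hi : ∀ i x, Integrable (fun y => a x y * (D y).real (E i)) M := fun i x =>
    h.integrable_likelihood_mul x (hDm i)
      fun y => by rw [abs_of_nonneg measureReal_nonneg]; exact measureReal_le_one
  have hP : bitErasureProb 𝒞 J W D =
      (∑ i ∈ J, (∑ x ∈ S, ∫ y, a x y * (D y).real (E i) ∂M) / #S) / #J := by
    rw [bitErasureProb, avgProb_eq]
    congr 1
    refine sum_congr rfl fun i _ => ?_
    congr 1
    exact sum_congr rfl fun x _ => h.decodedLaw_real D x (hEm i)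
  -- For almost every output, the decoder's guarantee holds simultaneously for every codeword
  -- compatible with that output.
  have hae : ∀ᵐ y ∂M, ∀ x ∈ S, ∀ i ∈ J, a x y ≠ 0 →
      ∀ᵐ z ∂D y, z i = none ∨ z i = some (x i) := by
    rw [Finset.eventually_all]
    intro x hx
    rw [Finset.eventually_all]
    intro i hi
    have h1 := Measure.ae_ae_of_ae_bind D.measurable.aemeasurable
      (hD x (by simpa [hS] using hx) i hi)
    rw [h.pi_law_eq, ae_withDensity_iff (ham x).ennreal_ofReal] at h1
    filter_upwards [h1] with y hy hne
    refine hy ?_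
    rw [Ne, ENNReal.ofReal_eq_zero, not_le]
    exact lt_of_le_of_ne (ha0 x y) (Ne.symm hne)
  refine ⟨?_, ?_⟩
  · rw [hP]
    exact div_nonneg (sum_nonneg fun i _ => div_nonneg (sum_nonneg fun x _ => integral_nonneg
      fun y => mul_nonneg (ha0 x y) measureReal_nonneg) hK.le) hJc.le
  have hle : ∀ᵐ y ∂M, weightedEntropy S (fun i => s (y i)) ≤
      ∑ i ∈ J, (∑ x ∈ S, a x y * (D y).real (E i)) / #S * Real.log 2 := by
    filter_upwards [hae] with y hy
    refine (weightedEntropy_le (fun x hx x' hx' => hJ.eq_of_forall (by simpa [hS] using hx)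
      (by simpa [hS] using hx')) fun i => h.abs_le (y i)).trans ?_
    rw [sum_div]
    refine sum_le_sum fun i hiJ => ?_
    rw [div_mul_eq_mul_div]
    refine div_le_div_of_nonneg_right ?_ hK.le
    change (∑ x ∈ S, a x y) * Real.binEntropy ((∑ x ∈ S with x i = 1, a x y) / ∑ x ∈ S, a x y) ≤ _
    have hrhs : 0 ≤ (∑ x ∈ S, a x y * (D y).real (E i)) * Real.log 2 :=
      mul_nonneg (sum_nonneg fun x _ => mul_nonneg (ha0 x y) measureReal_nonneg) log_two_pos.le
    -- If both values of bit `i` are compatible with the output, the decoder must erase it almost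
    -- surely, and log 2 bounds its entropy. Otherwise the bit is known and has zero entropy.
    by_cases h0 : ∃ x ∈ S, x i = 0 ∧ a x y ≠ 0
    · by_cases h1 : ∃ x ∈ S, x i = 1 ∧ a x y ≠ 0
      · obtain ⟨x, hx, hxi, hxa⟩ := h0
        obtain ⟨x', hx', hxi', hxa'⟩ := h1
        have : (D y).real (E i) = 1 := by
          rw [Measure.real, (mem_ae_iff_prob_eq_one (hEm i)).1, ENNReal.toReal_one]
          filter_upwards [hy x hx i hiJ hxa, hy x' hx' i hiJ hxa'] with z hz hz'
          rw [hxi] at hz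
          rw [hxi'] at hz'
          rcases hz with hz | hz
          · exact hz
          · rcases hz' with hz' | hz'
            · exact hz'
            · rw [hz] at hz'
              simp at hz'
        simp only [this, mul_one]
        exact mul_le_mul_of_nonneg_left Real.binEntropy_le_log_two (sum_nonneg fun x _ => ha0 x y)
      · push Not at h1
        rw [sum_eq_zero fun x hx => h1 x (mem_filter.1 hx).1 (mem_filter.1 hx).2]
        simpa using hrhs
    · push Not at h0
      have : ∑ x ∈ S with x i = 1, a x y = ∑ x ∈ S, a x y := by
        rw [← sum_fiberwise S (fun x => x i), sum_zmod_two,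
          sum_eq_zero fun x hx => h0 x (mem_filter.1 hx).1 (mem_filter.1 hx).2, zero_add]
      rw [this]
      by_cases hz : ∑ x ∈ S, a x y = 0
      · simpa [hz] using hrhs
      · rw [div_self hz]
        simpa using hrhs
  have hii : ∀ i, Integrable (fun y => (∑ x ∈ S, a x y * (D y).real (E i)) / #S * Real.log 2) M :=
    fun i => ((integrable_finsetSum _ fun x _ => hi i x).div_const _).mul_const _
  calc _ ≤ ∫ y, ∑ i ∈ J, (∑ x ∈ S, a x y * (D y).real (E i)) / #S * Real.log 2 ∂M :=
        integral_mono_ae (h.integrable_comp_pi (continuous_weightedEntropy S))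
          (integrable_finsetSum _ fun i _ => hii i) hle
    _ = ∑ i ∈ J, ∫ y, (∑ x ∈ S, a x y * (D y).real (E i)) / #S * Real.log 2 ∂M :=
        integral_finsetSum _ fun i _ => hii i
    _ = ∑ i ∈ J, (∑ x ∈ S, ∫ y, a x y * (D y).real (E i) ∂M) / #S * Real.log 2 :=
        sum_congr rfl fun i _ => by
          rw [integral_mul_const, integral_div, integral_finsetSum _ fun x _ => hi i x]
    _ = _ := by
        rw [hP, ← sum_mul]
        field_simp

end MBIOSChannel.HasBias

end Equivocation

/-! ### Average check degree, the two degree bounds, and their comparison. -/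

section Degree

/-! ### Tanner graphs -/

variable {n m : ℕ} {𝒞 : Submodule (ZMod 2) (Fin n → ZMod 2)}
  {H : Matrix (Fin m) (Fin n) (ZMod 2)} {J : Finset (Fin n)}

lemma IsFullRankParityCheck.finrank_add (hH : IsFullRankParityCheck H 𝒞) :
    Module.finrank (ZMod 2) 𝒞 + m = n := by
  have hk : 𝒞 = LinearMap.ker H.mulVecLin := by
    ext x
    rw [hH.2, LinearMap.mem_ker, Matrix.mulVecLin_apply]
  have := LinearMap.finrank_range_add_finrank_ker H.mulVecLin
  rw [← Matrix.rank, hH.1, ← hk] at this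
  simp at this
  omega

lemma IsFullRankParityCheck.card_le (hH : IsFullRankParityCheck H 𝒞) (hn : 0 < n) {R : ℝ}
    (hR : R ≤ rate 𝒞) : (m : ℝ) ≤ n * (1 - R) := by
  have hn' : (0 : ℝ) < n := by exact_mod_cast hn
  have h1 : (Module.finrank (ZMod 2) 𝒞 : ℝ) + m = n := by exact_mod_cast hH.finrank_add
  rw [rate, le_div_iff₀ hn'] at hR
  linarith

lemma DeterminedBy.nonempty (hJ : DeterminedBy 𝒞 J) (hR : 0 < rate 𝒞) : J.Nonempty := by
  by_contra hJ0
  rw [Finset.not_nonempty_iff_eq_empty] at hJ0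
  have : 𝒞 = ⊥ := (Submodule.eq_bot_iff _).2 fun x hx => hJ x hx (by simp [hJ0])
  rw [rate, this] at hR
  simp at hR

lemma ncard_neighborSet_inr (H : Matrix (Fin m) (Fin n) (ZMod 2)) (j : Fin m) :
    ((tannerGraph H).neighborSet (Sum.inr j)).ncard =
      (Finset.univ.filter fun i => H j i ≠ 0).card := by
  have : (tannerGraph H).neighborSet (Sum.inr j) =
      Sum.inl '' ((Finset.univ.filter fun i => H j i ≠ 0 : Finset (Fin n)) : Set (Fin n)) := by
    ext v
    simp only [SimpleGraph.mem_neighborSet, tannerGraph, SimpleGraph.fromRel_adj, Set.mem_image,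
      Finset.coe_filter, Finset.mem_univ, true_and, Set.mem_ofPred_eq]
    constructor
    · rintro ⟨-, ⟨i, j', h, -⟩ | ⟨i, j', rfl, h, h'⟩⟩
      · simp at h
      · cases h
        exact ⟨i, h', rfl⟩
    · rintro ⟨i, hi, rfl⟩
      exact ⟨by simp, Or.inr ⟨i, j, rfl, rfl, hi⟩⟩
  rw [this, Set.ncard_image_of_injective _ Sum.inl_injective, Set.ncard_coe_finset]

lemma avgRightDegree_eq (H : Matrix (Fin m) (Fin n) (ZMod 2)) :
    avgRightDegree (tannerGraph H) =
      (∑ j, ((Finset.univ.filter fun i => H j i ≠ 0).card : ℝ)) / m := by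
  simp only [avgRightDegree, ncard_neighborSet_inr]

/-- Jensen for the convex function x ↦ g^x over the check nodes. -/
lemma mul_rpow_avgRightDegree_le (H : Matrix (Fin m) (Fin n) (ZMod 2)) {g : ℝ} (hg : 0 < g) :
    m * g ^ avgRightDegree (tannerGraph H) ≤
      ∑ j, g ^ (Finset.univ.filter fun i => H j i ≠ 0).card := by
  rcases Nat.eq_zero_or_pos m with rfl | hm
  · simp
  have hm' : (0 : ℝ) < m := by exact_mod_cast hm
  have := (convexOn_rpow_left hg).map_sum_le (t := Finset.univ) (w := fun _ : Fin m => (m : ℝ)⁻¹)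
    (p := fun j => ((Finset.univ.filter fun i => H j i ≠ 0).card : ℝ))
    (fun _ _ => inv_nonneg.2 hm'.le) (by simp [hm'.ne']) fun _ _ => Set.mem_univ _
  simp only [smul_eq_mul, ← Finset.mul_sum, Real.rpow_natCast] at this
  rw [avgRightDegree_eq, div_eq_inv_mul]
  rw [le_inv_mul_iff₀ hm'] at this
  exact this

lemma avgRightDegree_nonneg (H : Matrix (Fin m) (Fin n) (ZMod 2)) :
    0 ≤ avgRightDegree (tannerGraph H) := by
  unfold avgRightDegree; positivity

/-- Concavity moves the average over checks inside, to the mean of g^deg. This mean is at least g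
raised to the average degree, and u ↦ `biasEntropy (√u)` is decreasing. -/
lemma sum_biasEntropy_sqrt_le (H : Matrix (Fin m) (Fin n) (ZMod 2)) {g : ℝ} (hg : 0 < g)
    (hg1 : g ≤ 1) :
    ∑ j, biasEntropy (Real.sqrt (g ^ (Finset.univ.filter fun i => H j i ≠ 0).card)) ≤
      m * biasEntropy (Real.sqrt (g ^ avgRightDegree (tannerGraph H))) := by
  rcases Nat.eq_zero_or_pos m with rfl | hm
  · simp
  have hm' : (0 : ℝ) < m := by exact_mod_cast hm
  have hmem : ∀ k : ℕ, g ^ k ∈ Set.Icc (0 : ℝ) 1 := fun k =>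
    ⟨pow_nonneg hg.le k, pow_le_one₀ hg.le hg1⟩
  have hw : ∑ _j : Fin m, (m : ℝ)⁻¹ = 1 := by simp [hm'.ne']
  have h1 := concaveOn_biasEntropy_sqrt.le_map_sum (t := Finset.univ)
    (w := fun _ : Fin m => (m : ℝ)⁻¹)
    (p := fun j => g ^ (Finset.univ.filter fun i => H j i ≠ 0).card)
    (fun _ _ => inv_nonneg.2 hm'.le) hw fun _ _ => hmem _
  have h2 := (convex_Icc (0 : ℝ) 1).sum_mem (t := Finset.univ) (w := fun _ : Fin m => (m : ℝ)⁻¹)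
    (z := fun j => g ^ (Finset.univ.filter fun i => H j i ≠ 0).card)
    (fun _ _ => inv_nonneg.2 hm'.le) hw fun _ _ => hmem _
  simp only [smul_eq_mul, ← Finset.mul_sum] at h1 h2
  rw [inv_mul_le_iff₀ hm'] at h1
  refine h1.trans (mul_le_mul_of_nonneg_left ?_ hm'.le)
  refine antitoneOn_biasEntropy_sqrt ⟨by positivity, Real.rpow_le_one hg.le hg1
    (avgRightDegree_nonneg H)⟩ h2 ?_
  rw [le_inv_mul_iff₀ hm']
  exact mul_rpow_avgRightDegree_le H hg

/-! ### The lower bounds on the average degree -/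

/-- The degenerate capacities give g = 0 or g = 1. With the conventions 1/0 = 0 and log 0 = 0 the
denominator vanishes in both cases, and division by zero gives the intended value 0. -/
lemma rightDegreeBound_zero (C ε Pb : ℝ) : rightDegreeBound C ε Pb 0 = 0 := by
  simp [rightDegreeBound]

lemma rightDegreeBound_one (C ε Pb : ℝ) : rightDegreeBound C ε Pb 1 = 0 := by
  simp [rightDegreeBound]

lemma log_one_div_nonneg {x : ℝ} (h0 : 0 ≤ x) (h1 : x ≤ 1) : 0 ≤ Real.log (1 / x) := by
  rw [one_div, Real.log_inv]
  linarith [Real.log_nonpos h0 h1]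

lemma rightDegreeBound_mono (C ε Pb : ℝ) {g g' : ℝ} (hg : 0 < g) (hgg' : g ≤ g') (hg' : g' < 1) :
    rightDegreeBound C ε Pb g ≤ rightDegreeBound C ε Pb g' := by
  unfold rightDegreeBound
  set a := (1 - C - h2 Pb) / (1 - (1 - ε) * C)
  have h0 : 0 < g' := hg.trans_le hgg'
  refine div_le_div_of_nonneg_left (mul_nonneg two_pos.le (log_one_div_nonneg ?_ ?_)) ?_ ?_
  · linarith [(h2Inv_mem a).2]
  · linarith [(h2Inv_mem a).1]
  · exact Real.log_pos (by rwa [one_lt_div h0])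
  · exact Real.log_le_log (by positivity) (one_div_le_one_div_of_le hg hgg')

/-- The rate deficit `1 - (1 - ε) C` exceeds `1 - C`. -/
lemma one_sub_lt_one_sub_mul {C ε : ℝ} (hC : 0 < C) (hε : 0 < ε) : 1 - C < 1 - (1 - ε) * C := by
  nlinarith

namespace MBIOSChannel.HasBias

variable {𝒴 : Type*} [MeasurableSpace 𝒴] {W : MBIOSChannel 𝒴} {μ : Measure 𝒴} {s : 𝒴 → ℝ}
  {T : 𝒴 → 𝒴}

lemma g1_eq_zero (h : W.HasBias μ s T) [IsProbabilityMeasure μ] (hC : W.capacity = 0) :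
    W.g1 = 0 := by
  refine le_antisymm ?_ h.g1_mem.1
  have := h.g1_le
  rw [hC, sub_zero, h2Inv_one] at this
  norm_num at this
  exact this

lemma g1_eq_one (h : W.HasBias μ s T) [IsProbabilityMeasure μ] (hC : W.capacity = 1) :
    W.g1 = 1 :=
  le_antisymm h.g1_mem.2 (hC ▸ h.capacity_le_g1)

lemma _root_.TannerBound.sq_one_sub_h2Inv_lt_one {C : ℝ} (h0 : 0 ≤ C) (h1 : C < 1) :
    (1 - 2 * h2Inv (1 - C)) ^ 2 < 1 := by
  have := h2Inv_pos (y := 1 - C) (by linarith) (by linarith)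
  have := (h2Inv_mem (1 - C)).2
  nlinarith

lemma rightDegreeBound_le (h : W.HasBias μ s T) [IsProbabilityMeasure μ]
    (hH : IsFullRankParityCheck H 𝒞) (hJ : DeterminedBy 𝒞 J) {ε : ℝ} (hε0 : 0 < ε) (hε1 : ε < 1)
    (hR : (1 - ε) * W.capacity ≤ rate 𝒞) (D : Kernel (Fin n → 𝒴) (Fin n → ZMod 2))
    [IsMarkovKernel D] :
    rightDegreeBound W.capacity ε (bitErrorProb 𝒞 J W D) W.g1 ≤
      avgRightDegree (tannerGraph H) := by
  classical
  obtain ⟨hC0, hC1⟩ := h.capacity_mem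
  rcases hC0.eq_or_lt with hC | hC0
  · rw [h.g1_eq_zero hC.symm, rightDegreeBound_zero]; exact avgRightDegree_nonneg H
  rcases hC1.eq_or_lt with hC | hC1
  · rw [h.g1_eq_one hC, rightDegreeBound_one]; exact avgRightDegree_nonneg H
  have hg0 : 0 < W.g1 := hC0.trans_le h.capacity_le_g1
  have hg1 : W.g1 < 1 := h.g1_le.trans_lt (sq_one_sub_h2Inv_lt_one hC0.le hC1)
  have hJ0 : J.Nonempty := hJ.nonempty ((mul_pos (by linarith) hC0).trans_le hR)
  have hJn : (J.card : ℝ) ≤ n := by exact_mod_cast J.card_le_univ.trans_eq (Fintype.card_fin n)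
  have hn : (0 : ℝ) < n := lt_of_lt_of_le (by exact_mod_cast hJ0.card_pos) hJn
  have hmn := hH.card_le (by exact_mod_cast hn) hR
  obtain ⟨⟨hP0, hP1⟩, hfano⟩ := h.integral_weightedEntropy_le_error hJ hJ0 D
  set Pb := bitErrorProb 𝒞 J W D
  set d := avgRightDegree (tannerGraph H) with hd
  set A := 1 - (1 - ε) * W.capacity with hA
  have hAC : 1 - W.capacity < A := one_sub_lt_one_sub_mul hC0 hε0
  have hA0 : 0 < A := by linarith
  -- r = g₁^(d/2) bounds the effective bias of an average syndrome bit.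
  set r := Real.sqrt (W.g1 ^ d) with hr
  have hr0 : 0 < r := Real.sqrt_pos.2 (Real.rpow_pos_of_pos hg0 d)
  have hr1 : r ≤ 1 := Real.sqrt_le_one.2 (Real.rpow_le_one hg0.le hg1.le (avgRightDegree_nonneg H))
  have hlower := h.le_integral_weightedEntropy hH
  have hsum : ∑ j, ∫ y : Fin n → 𝒴, biasEntropy (∏ i with H j i ≠ 0, s (y i))
      ∂Measure.pi (fun _ => μ) ≤ m * biasEntropy r :=
    (Finset.sum_le_sum fun j _ => h.integral_biasEntropy_prod_le _).trans
      (sum_biasEntropy_sqrt_le H hg0 hg1.le)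
  have hb0 : 0 ≤ biasEntropy r := biasEntropy_nonneg (by rwa [abs_of_pos hr0])
  have hB0 := Real.binEntropy_nonneg hP0 hP1
  -- The two bounds on the equivocation, combined with |J| ≤ n and m ≤ nA.
  have hmain : n * ((1 - W.capacity) * Real.log 2) ≤
      n * (Real.binEntropy Pb + A * biasEntropy r) := by
    have e1 := mul_le_mul_of_nonneg_right hJn hB0
    have e2 := mul_le_mul_of_nonneg_right hmn hb0
    linarith
  have hmain' := le_of_mul_le_mul_left hmain hn
  have harg : (1 - W.capacity - h2 Pb) / A ≤ h2 ((1 - r) / 2) := by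
    rw [h2_eq_biasEntropy ((1 - r) / 2), div_le_div_iff₀ hA0 log_two_pos, h2, sub_mul,
      div_mul_cancel₀ _ log_two_pos.ne', show 1 - 2 * ((1 - r) / 2) = r by ring]
    linarith
  have hle := h2Inv_le (x := (1 - r) / 2) ⟨by linarith, by linarith⟩ harg
  unfold rightDegreeBound
  set t := h2Inv ((1 - W.capacity - h2 Pb) / A)
  have hlog : 0 < Real.log (1 / W.g1) := Real.log_pos (by rwa [one_lt_div hg0])
  rw [div_le_iff₀ hlog, one_div, one_div, Real.log_inv, Real.log_inv]
  have h3 : Real.log r ≤ Real.log (1 - 2 * t) := Real.log_le_log hr0 (by linarith)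
  rw [hr, Real.log_sqrt (Real.rpow_nonneg hg0.le _), Real.log_rpow hg0] at h3
  linarith

end MBIOSChannel.HasBias

/-! ### The extreme channels -/

/-- Here s² is constant, which is the equality case of Jensen. -/
lemma bsc_capacity_and_g1 (q : unitInterval) :
    (bsc q).capacity = 1 - h2 q ∧ (bsc q).g1 = (1 - 2 * q) ^ 2 := by
  obtain ⟨μ, T, hμ, h⟩ := exists_hasBias_bsc q
  have h1 := h.biasEntropy_integral
  have e : ∀ y, biasEntropy ((1 - 2 * q) * sgn y) = biasEntropy (1 - 2 * q) := fun y => by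
    rcases zmod_two_cases y with rfl | rfl <;> simp [← biasEntropy_neg (1 - 2 * (q : ℝ))]
  simp only [e, integral_const, probReal_univ, smul_eq_mul, one_mul] at h1
  refine ⟨?_, ?_⟩
  · rw [h2_eq_biasEntropy, h1, mul_div_cancel_right₀ _ log_two_pos.ne']; ring
  · rw [h.g1_eq]
    simp [mul_pow, sgn_sq]

/-- Equality in the chord bound at u = 0 and u = 1. It makes the BEC extremal and its syndrome bit
entropies exact. -/
lemma biasEntropy_of_trit {t : ℝ} (h : t = 0 ∨ t = 1 ∨ t = -1) :
    biasEntropy t = (1 - t ^ 2) * Real.log 2 := by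
  rcases h with rfl | rfl | rfl
  · simp [biasEntropy_zero]
  · simp [biasEntropy_one]
  · simp [biasEntropy_neg, biasEntropy_one]

lemma erasure_trit (y : Option (ZMod 2)) :
    Option.elim y 0 sgn = 0 ∨ Option.elim y 0 sgn = 1 ∨ Option.elim y 0 sgn = -1 := by
  cases y with
  | none => simp
  | some b => rcases zmod_two_cases b with rfl | rfl <;> simp

lemma bec_capacity_and_g1 (p : unitInterval) :
    (bec p).capacity = 1 - p ∧ (bec p).g1 = 1 - p := by
  obtain ⟨μ, T, hμ, hp, h⟩ := exists_hasBias_bec p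
  have i2 := h.integrable_comp (φ := fun t => t ^ 2) (by fun_prop)
  have hg : (bec p).g1 = 1 - p := by
    have e : ∀ y : Option (ZMod 2), Option.elim y 0 sgn ^ 2 =
        1 - Set.indicator {none} (fun _ => (1 : ℝ)) y := by
      intro y
      cases y with
      | none => simp
      | some b => simp [sgn_sq]
    rw [h.g1_eq]
    simp only [e]
    rw [integral_sub (integrable_const _)
      ((integrable_const _).indicator (MeasurableSet.singleton none)),
      integral_indicator_const _ (MeasurableSet.singleton none), hp]
    simp
  refine ⟨?_, hg⟩
  have h1 := h.biasEntropy_integral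
  simp only [biasEntropy_of_trit (erasure_trit _)] at h1
  rw [integral_mul_const, integral_sub (integrable_const _) i2, ← h.g1_eq, hg] at h1
  have := mul_right_cancel₀ log_two_pos.ne' h1
  simp at this
  linarith

lemma becRightDegreeBound_le {p : unitInterval} (hH : IsFullRankParityCheck H 𝒞)
    (hJ : DeterminedBy 𝒞 J) {ε : ℝ} (hε0 : 0 < ε) (hε1 : ε < 1)
    (hR : (1 - ε) * (bec p).capacity ≤ rate 𝒞)
    (D : Kernel (Fin n → Option (ZMod 2)) (Fin n → Option (ZMod 2))) [IsMarkovKernel D]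
    (hD : IsErasureDecoder 𝒞 J (bec p) D) :
    becRightDegreeBound p ε (bitErasureProb 𝒞 J (bec p) D) ≤ avgRightDegree (tannerGraph H) := by
  classical
  obtain ⟨hC, hg⟩ := bec_capacity_and_g1 p
  rw [hC] at hR
  rcases p.2.1.eq_or_lt with h0 | hp0
  · rw [becRightDegreeBound, ← h0]; simpa using avgRightDegree_nonneg H
  rcases p.2.2.eq_or_lt with h1 | hp1
  · rw [becRightDegreeBound, h1]; simpa using avgRightDegree_nonneg H
  obtain ⟨μ, T, hμ, hp, h⟩ := exists_hasBias_bec p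
  have hg0 : 0 < 1 - (p : ℝ) := by linarith
  have hJ0 : J.Nonempty := hJ.nonempty ((mul_pos (by linarith) hg0).trans_le hR)
  have hJn : (J.card : ℝ) ≤ n := by exact_mod_cast J.card_le_univ.trans_eq (Fintype.card_fin n)
  have hn : (0 : ℝ) < n := lt_of_lt_of_le (by exact_mod_cast hJ0.card_pos) hJn
  have hmn := hH.card_le (by exact_mod_cast hn) hR
  obtain ⟨hP0, hupper⟩ := h.integral_weightedEntropy_le_erasure hJ hJ0 D hD
  have hlower := h.le_integral_weightedEntropy hH
  have hprod : ∀ j, ∫ y : Fin n → Option (ZMod 2),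
      biasEntropy (∏ i with H j i ≠ 0, Option.elim (y i) 0 sgn) ∂Measure.pi (fun _ => μ) =
      (1 - (1 - (p : ℝ)) ^ (Finset.univ.filter fun i => H j i ≠ 0).card) * Real.log 2 := by
    intro j
    have e : ∀ y : Fin n → Option (ZMod 2),
        biasEntropy (∏ i with H j i ≠ 0, Option.elim (y i) 0 sgn) =
        (1 - (∏ i with H j i ≠ 0, Option.elim (y i) 0 sgn) ^ 2) * Real.log 2 := fun y =>
      -- The set {0, 1, -1} is closed under multiplication, so the bias of a syndrome bit stays in
      -- it.
      biasEntropy_of_trit (Finset.prod_induction _ (fun t : ℝ => t = 0 ∨ t = 1 ∨ t = -1)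
        (by rintro a b (rfl | rfl | rfl) (rfl | rfl | rfl) <;> simp) (by simp)
        fun i _ => erasure_trit _)
    simp only [e]
    rw [integral_mul_const, integral_sub (integrable_const _)
      (h.integrable_comp_pi (φ := fun t => (∏ i with H j i ≠ 0, t i) ^ 2) (by fun_prop)),
      h.integral_prod_sq, hg]
    simp
  simp only [hprod, ← Finset.sum_mul, Finset.sum_sub_distrib, hC] at hlower
  set Pb := bitErasureProb 𝒞 J (bec p) D
  set d := avgRightDegree (tannerGraph H) with hd
  have hconv := mul_rpow_avgRightDegree_le H hg0
  rw [← hd] at hconv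
  have hgd0 : 0 < (1 - (p : ℝ)) ^ d := Real.rpow_pos_of_pos hg0 d
  have hgd1 : (1 - (p : ℝ)) ^ d ≤ 1 :=
    Real.rpow_le_one hg0.le (by linarith) (avgRightDegree_nonneg H)
  have hlog2 := log_two_pos
  have hmain : (n : ℝ) * p - m * (1 - (1 - (p : ℝ)) ^ d) ≤ n * Pb := by
    have e1 := (hlower.trans hupper)
    have e2 : ((n : ℝ) * p - (m - ∑ j, (1 - (p : ℝ)) ^ (Finset.univ.filter fun i =>
        H j i ≠ 0).card)) * Real.log 2 ≤ (J.card * Pb) * Real.log 2 := by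
      simp only [Finset.sum_const, Finset.card_univ, Fintype.card_fin, nsmul_eq_mul, mul_one,
        sub_sub_cancel] at e1
      linarith
    have e3 := le_of_mul_le_mul_right e2 hlog2
    have e4 := mul_le_mul_of_nonneg_right hJn hP0
    linarith
  have hmain' : (n : ℝ) * (p - Pb) ≤ n * ((1 - (1 - ε) * (1 - p)) * (1 - (1 - (p : ℝ)) ^ d)) := by
    have := mul_le_mul_of_nonneg_right hmn (sub_nonneg.2 hgd1)
    linarith
  have hfin := le_of_mul_le_mul_left hmain' hn
  set A := 1 - (1 - ε) * (1 - (p : ℝ)) with hA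
  set B := (1 - (p : ℝ)) * ε + Pb with hB
  have hB0 : 0 < B := by positivity
  have hAB : A = B + (p - Pb) := by rw [hA, hB]; ring
  have hA0 : 0 < A := by
    have : 0 < (1 - (p : ℝ)) * ε := by positivity
    rw [hAB, hB]; linarith
  have hlogg : 0 < Real.log (1 / (1 - (p : ℝ))) :=
    Real.log_pos (by rw [one_lt_div hg0]; linarith)
  -- `hfin` reads p - Pb ≤ A(1 - (1 - p)^d), and A - (p - Pb) = B.
  have hle : (1 - (p : ℝ)) ^ d ≤ B / A := by
    rw [le_div_iff₀ hA0]; linarith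
  have := Real.log_le_log hgd0 hle
  rw [Real.log_rpow hg0, Real.log_div hB0.ne' hA0.ne'] at this
  rw [becRightDegreeBound, ← hB, div_le_iff₀ hlogg, show 1 + (p - Pb) / B = A / B by
    rw [hAB]; field_simp, Real.log_div hA0.ne' hB0.ne', one_div, Real.log_inv]
  linarith

/-- Both bounds have the same denominator, so the claim is B/A ≤ (1 - 2t)² with t = h₂⁻¹(a). It
follows from 1 - (1 - 2t)² ≤ h₂(t) = a ≤ (p - Pb)/A when a > 0, the last inequality being Pb ≤
h₂(Pb). -/
lemma rightDegreeBound_le_becRightDegreeBound {p ε Pb : ℝ} (hp0 : 0 ≤ p) (hp1 : p ≤ 1)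
    (hε : 0 < ε) (hP0 : 0 ≤ Pb) (hP1 : Pb ≤ 1 / 2) (hPp : Pb ≤ p) :
    rightDegreeBound (1 - p) ε Pb (1 - p) ≤ becRightDegreeBound p ε Pb := by
  rcases hp0.eq_or_lt with rfl | hp0
  · simp [rightDegreeBound, becRightDegreeBound]
  rcases hp1.eq_or_lt with rfl | hp1
  · simp [rightDegreeBound, becRightDegreeBound]
  have hg0 : 0 < 1 - p := by linarith
  refine div_le_div_of_nonneg_right ?_ (Real.log_pos (by rw [one_lt_div hg0]; linarith)).le
  set A := 1 - (1 - ε) * (1 - p) with hA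
  set B := (1 - p) * ε + Pb with hB
  have hB0 : 0 < B := by positivity
  have hAB : A = B + (p - Pb) := by rw [hA, hB]; ring
  have hA0 : 0 < A := by linarith
  have hpA : p < A := by
    have : 0 < (1 - p) * ε := by positivity
    rw [hAB, hB]; linarith
  have hh0 := h2_nonneg hP0 (by linarith)
  rw [sub_sub_cancel]
  set a := (p - h2 Pb) / A with ha
  have ha1 : a < 1 := by rw [ha, div_lt_one hA0]; linarith
  have ht := h2Inv_lt_half ha1
  have ht0 := (h2Inv_mem a).1
  have hsq : B / A ≤ (1 - 2 * h2Inv a) ^ 2 := by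
    have hBA : B / A = 1 - (p - Pb) / A := by
      rw [eq_sub_iff_add_eq, ← add_div, div_eq_one_iff_eq hA0.ne', hAB]
    -- For a ≤ 0 the inverse is 0 and only B ≤ A is needed, that is, Pb ≤ p.
    rcases le_or_gt a 0 with h | h
    · rw [h2Inv_of_nonpos h]
      norm_num
      rw [div_le_one hA0]; linarith
    · have h1 := one_sub_sq_le_h2 ht0 (by linarith)
      rw [h2_h2Inv h.le ha1.le] at h1
      have h3 : a ≤ (p - Pb) / A :=
        div_le_div_of_nonneg_right (by linarith [le_h2_self hP0 hP1]) hA0.le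
      linarith
  have := Real.log_le_log (by positivity) hsq
  rw [Real.log_pow, Real.log_div hB0.ne' hA0.ne'] at this
  rw [show 1 + (p - Pb) / B = A / B by rw [hAB]; field_simp, Real.log_div hA0.ne' hB0.ne', one_div,
    Real.log_inv]
  push_cast at this
  linarith

end Degree

end TannerBound

open TannerBound in
theorem theorem1 {𝒴 : Type*} [MeasurableSpace 𝒴] (W : MBIOSChannel 𝒴) {n m : ℕ}
    (𝒞 : Submodule (ZMod 2) (Fin n → ZMod 2)) (H : Matrix (Fin m) (Fin n) (ZMod 2))
    (hH : IsFullRankParityCheck H 𝒞) (J : Finset (Fin n)) (hJ : DeterminedBy 𝒞 J)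
    (ε : ℝ) (hε0 : 0 < ε) (hε1 : ε < 1) :
    -- the integral formula for `g₁` in terms of the law of the log-likelihood ratio
    (W.g1 = ∫ l in Set.Ioi (0 : EReal), (1 + (EReal.exp (-l)).toReal) * tanhHalf l ^ 2 ∂W.llrLaw) ∧
    -- the bound for the channel `W`, under any decoding algorithm
    ((1 - ε) * W.capacity ≤ rate 𝒞 →
      ∀ D : Kernel (Fin n → 𝒴) (Fin n → ZMod 2), IsMarkovKernel D →
        rightDegreeBound W.capacity ε (bitErrorProb 𝒞 J W D) W.g1 ≤
          avgRightDegree (tannerGraph H)) ∧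
    -- the tightened bound for the binary erasure channel
    (∀ p : unitInterval,
      (bec p).capacity = 1 - p ∧
      ((1 - ε) * (bec p).capacity ≤ rate 𝒞 →
        ∀ D : Kernel (Fin n → Option (ZMod 2)) (Fin n → Option (ZMod 2)), IsMarkovKernel D →
          IsErasureDecoder 𝒞 J (bec p) D →
            becRightDegreeBound p ε (bitErasureProb 𝒞 J (bec p) D) ≤
              avgRightDegree (tannerGraph H)) ∧
      (∀ Pb : ℝ, 0 ≤ Pb → Pb ≤ 1 / 2 → Pb ≤ p →
        rightDegreeBound (bec p).capacity ε Pb (bec p).g1 ≤ becRightDegreeBound p ε Pb)) ∧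
    -- the extreme channels among all those with the capacity of `W`
    (W.capacity ≤ W.g1 ∧ W.g1 ≤ (1 - 2 * h2Inv (1 - W.capacity)) ^ 2 ∧
      ∃ p q : unitInterval, (p : ℝ) = 1 - W.capacity ∧ (q : ℝ) = h2Inv (1 - W.capacity) ∧
        (bec p).capacity = W.capacity ∧ (bsc q).capacity = W.capacity ∧
        (bec p).g1 = W.capacity ∧ (bsc q).g1 = (1 - 2 * h2Inv (1 - W.capacity)) ^ 2 ∧
        ∀ Pb : ℝ, 0 ≤ Pb → Pb ≤ 1 →
          rightDegreeBound W.capacity ε Pb (bec p).g1 ≤ rightDegreeBound W.capacity ε Pb W.g1 ∧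
          rightDegreeBound W.capacity ε Pb W.g1 ≤
            rightDegreeBound W.capacity ε Pb (bsc q).g1) := by
  obtain ⟨μ, s, T, hμ, h⟩ := exists_hasBias W
  obtain ⟨hC0, hC1⟩ := h.capacity_mem
  refine ⟨h.g1_eq.trans h.setIntegral_llrLaw_eq.symm,
    fun hR D _ => h.rightDegreeBound_le hH hJ hε0 hε1 hR D,
    fun p => ⟨(bec_capacity_and_g1 p).1,
      fun hR D _ hD => becRightDegreeBound_le hH hJ hε0 hε1 hR D hD, fun Pb h0 h1 h2 => ?_⟩,
    h.capacity_le_g1, h.g1_le, ⟨1 - W.capacity, by linarith, by linarith⟩,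
    ⟨h2Inv (1 - W.capacity), (h2Inv_mem _).1, by linarith [(h2Inv_mem (1 - W.capacity)).2]⟩,
    rfl, rfl, ?_, ?_, ?_, (bsc_capacity_and_g1 _).2, fun Pb _ _ => ?_⟩
  · rw [(bec_capacity_and_g1 p).1, (bec_capacity_and_g1 p).2]
    exact rightDegreeBound_le_becRightDegreeBound p.2.1 p.2.2 hε0 h0 h1 h2
  · rw [(bec_capacity_and_g1 _).1, sub_sub_cancel]
  · rw [(bsc_capacity_and_g1 _).1, h2_h2Inv (by linarith) (by linarith), sub_sub_cancel]
  · rw [(bec_capacity_and_g1 _).2, sub_sub_cancel]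
  · rw [(bec_capacity_and_g1 _).2, (bsc_capacity_and_g1 _).2]
    simp only [sub_sub_cancel]
    -- At capacity 0 or 1 the two bounds on g₁ coincide, so all three values of g agree. Otherwise
    -- the degree bound is monotone in g on (0, 1).
    rcases hC0.eq_or_lt with hC | hC0
    · rw [h.g1_eq_zero hC.symm, ← hC, sub_zero, h2Inv_one]
      norm_num
    rcases hC1.eq_or_lt with hC | hC1
    · rw [h.g1_eq_one hC, hC, sub_self, h2Inv_zero]
      norm_num
    have hlt := sq_one_sub_h2Inv_lt_one hC0.le hC1
    exact ⟨rightDegreeBound_mono _ _ _ hC0 h.capacity_le_g1 (h.g1_le.trans_lt hlt),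
      rightDegreeBound_mono _ _ _ (hC0.trans_le h.capacity_le_g1) h.g1_le hlt⟩
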